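/- Setting. Let $(A,Q)$ be the algebra of functions on a coordinate patch of an $NQ$-manifold $\mathcal M$: a non-negatively graded commutative $\mathbb R$-algebra with a derivation $Q$ of degree $1$ and $Q^2=0$. Let $\mathcal E\to\mathcal M$ be a $Q$-equivariant graded vector bundle of finite rank in a trivialization with fibre coordinates $\zeta_\alpha$ of degree (level) $|\alpha|\in\mathbb Z$; write $(-1)^\alpha$ for $(-1)^{|\alpha|}$. The lift of $Q$ is $\hat Q\zeta_\alpha=(-1)^\beta\zeta_\beta T^\beta{}_\alpha$ with $T^\alpha{}_\beta\in A$ of degree $|\beta|-|\alpha|+1$ and $(-1)^\beta QT^\beta{}_\alpha+(-1)^\gamma T^\beta{}_\gamma T^\gamma{}_\alpha=0$. (Repeated indices are summed.) For a graded commutative test algebra $\Lambda$ (degrees in $\mathbb Z$, finite-dimensional homogeneous pieces), a $\Lambda$-family of super-curves is a morphism of graded algebras $A\to (C^\infty([0,1])\otimes\Lambda)[\theta]$, $\deg\theta=1$, $\theta^2=0$; it sends $f$ to a superfield $\boldsymbol f=f(t)+\theta\,\partial_\theta\boldsymbol f(t)$. Components of negative degree are kept, and no compatibility with $Q$ is required.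 The BRST differential $\delta_B$ on functions of super-curves is the odd vector field with $\delta_B\boldsymbol x=\boldsymbol{Qx}-\theta\partial_t\boldsymbol x$, that is $F(\boldsymbol x+\tau(\boldsymbol{Qx}-\theta\partial_t\boldsymbol x))=F(\boldsymbol x)+\tau\,\delta_BF(\boldsymbol x)$ with $\deg\tau=-1$, $\tau^2=0$. The Wilson line is the path-ordered exponential $U(t,s)=\mathbb P\exp(-\int_s^t dt\,d\theta\,\boldsymbol T)=\sum_q(-1)^q\int_s^t dt_1\int_s^{t_1}dt_2\cdots\int_s^{t_{q-1}}dt_q\;\partial_\theta\boldsymbol T(t_1)\cdots\partial_\theta\boldsymbol T(t_q)$. Let $\epsilon=(\epsilon^\alpha{}_\beta)$, $\epsilon^\alpha{}_\beta\in A$ of degree $|\beta|-|\alpha|$, be an infinitesimal change of trivialization. It acts by $\delta_\epsilon\zeta_\alpha=\zeta_\beta\epsilon^\beta{}_\alpha$, $\delta_\epsilon\zeta^\alpha=-\epsilon^\alpha{}_\beta\zeta^\beta$ and $$\delta_\epsilon T^\beta{}_\alpha=Q\epsilon^\beta{}_\alpha+T^\beta{}_\gamma\epsilon^\gamma{}_\alpha-(-1)^{\beta+\gamma}\epsilon^\beta{}_\gamma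 T^\gamma{}_\alpha ,$$ and $\delta_\epsilon U$ is the derivative at $s=0$ of the Wilson line of $T+s\,\delta_\epsilon T$. Put $$V^\alpha{}_\beta=\int_0^1dt\;U^\alpha{}_\delta(1,t)\,(-1)^\delta\,\partial_\theta\boldsymbol\epsilon^\delta{}_\gamma(t)\,U^\gamma{}_\beta(t,0).$$ Statement. The series for $U$ (for $T$ and for every $T+s\,\delta_\epsilon T$) converge, the integral $V$ exists, and for every family of super-curves: 1. $$\delta_\epsilon U^\alpha{}_\beta(1,0)=-\epsilon^\alpha{}_\delta(1)U^\delta{}_\beta(1,0)+U^\alpha{}_\delta(1,0)\epsilon^\delta{}_\beta(0)+(-1)^\alpha\delta_BV^\alpha{}_\beta+(-1)^\alpha T^\alpha{}_\delta(1)V^\delta{}_\beta+(-1)^\delta V^\alpha{}_\delta T^\delta{}_\beta(0).$$ 2. Equivalently, let $U_C=\zeta_\alpha U^\alpha{}_\beta(1,0)\zeta^\beta$ with $\zeta_\alpha$ the fibre coordinates over the final point and $\zeta^\beta$ the dual ones over the initial point, and let $\delta_B$ act also by $\delta_B\zeta_\alpha=(-1)^\beta\zeta_\beta T^\beta{}_\alpha(1)$,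 $\delta_B\zeta^\alpha=-T^\alpha{}_\beta(0)\zeta^\beta$. Then $\delta_\epsilon U_C=\delta_B(\zeta_\alpha V^\alpha{}_\beta\zeta^\beta)$. 3. Suppose all $\epsilon^\alpha{}_\beta$ have degree $0$. On the space of solutions, i.e. for families whose negative-degree components vanish and which satisfy the equations of motion (for $f\in A$ of degree $0$: $\partial_\theta\boldsymbol f=0$ and $\partial_\theta\boldsymbol{Qf}=\partial_tf$), the Wilson line is covariant: $\delta_\epsilon U(1,0)=-\epsilon(1)U(1,0)+U(1,0)\epsilon(0)$. 4. For every $\epsilon$ (homogeneous as above) and every family of closed super-curves (coinciding end points, $f(1)=f(0)$ for all $f\in A$, in particular super-loops) in the space of solutions, the Wilson loop $U_{\mathrm O}=\sum_\alpha(-1)^\alpha U^\alpha{}_\alpha(1,0)$ satisfies $\delta_\epsilon U_{\mathrm O}=0$. -/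

import Mathlib

open scoped TensorProduct ContDiff

universe u v

noncomputable section

namespace WilsonLine

/-! ## Graded commutative algebras -/

/-- A `ℤ`-graded commutative algebra over `ℝ`: `a b = (-1)^(ij) b a` for `a`, `b` of degrees
`i`, `j`. -/
structure GrAlg where
  carrier : Type u
  [ring : Ring carrier]
  [algebra : Algebra ℝ carrier]
  gr : ℤ → Submodule ℝ carrier
  [graded : GradedAlgebra gr]
  comm : ∀ {i j : ℤ} {a b : carrier}, a ∈ gr i → b ∈ gr j →
    a * b = (-1 : ℝ) ^ (i * j) • (b * a)

attribute [instance] GrAlg.ring GrAlg.algebra GrAlg.graded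

/-- The parity involution as a linear map. -/
def GrAlg.parityLin (G : GrAlg.{u}) : G.carrier →ₗ[ℝ] G.carrier :=
  (DirectSum.toModule ℝ ℤ G.carrier (fun i => (-1 : ℝ) ^ i • (G.gr i).subtype)) ∘ₗ
    (DirectSum.decomposeLinearEquiv G.gr).toLinearMap

theorem GrAlg.parityLin_of_mem (G : GrAlg.{u}) {i : ℤ} {a : G.carrier} (ha : a ∈ G.gr i) :
    G.parityLin a = (-1 : ℝ) ^ i • a := by
  lift a to G.gr i using ha
  simp only [GrAlg.parityLin, LinearMap.comp_apply, LinearEquiv.coe_coe,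
    DirectSum.decomposeLinearEquiv_apply_coe, DirectSum.toModule_lof]
  simp

theorem neg_one_sq_zpow (i : ℤ) : (-1 : ℝ) ^ i * (-1 : ℝ) ^ i = 1 := by
  rw [← mul_zpow]; simp

theorem GrAlg.parityLin_mul (G : GrAlg.{u}) (a b : G.carrier) :
    G.parityLin (a * b) = G.parityLin a * G.parityLin b := by
  refine DirectSum.Decomposition.inductionOn G.gr
    (motive := fun a => G.parityLin (a * b) = G.parityLin a * G.parityLin b) ?_ ?_ ?_ a
  · simp
  · intro i x
    refine DirectSum.Decomposition.inductionOn G.gr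
      (motive := fun b => G.parityLin (x * b) = G.parityLin x * G.parityLin b) ?_ ?_ ?_ b
    · simp
    · intro j y
      rw [G.parityLin_of_mem (SetLike.mul_mem_graded x.2 y.2), G.parityLin_of_mem x.2,
        G.parityLin_of_mem y.2, smul_mul_smul_comm, zpow_add₀ (by norm_num)]
    · intro y z hy hz
      simp [mul_add, hy, hz]
  · intro y z hy hz
    simp [add_mul, hy, hz]

/-- The parity involution `a ↦ (-1)^|a| a`. -/
def GrAlg.parity (G : GrAlg.{u}) : G.carrier →ₐ[ℝ] G.carrier :=
  AlgHom.ofLinearMap G.parityLin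
    (by simpa using G.parityLin_of_mem (SetLike.one_mem_graded G.gr)) G.parityLin_mul

theorem GrAlg.parity_of_mem (G : GrAlg.{u}) {i : ℤ} {a : G.carrier} (ha : a ∈ G.gr i) :
    G.parity a = (-1 : ℝ) ^ i • a := G.parityLin_of_mem ha

/-! ## Adjoining an odd variable -/

/-- The algebra `R[θ]` with one odd variable, `θ ^ 2 = 0`. The pair `(a, b)` stands for `a + θ b`,
and `a θ = θ σ(a)`, where `σ` is the parity involution of `R`. -/
def OddExt {R : Type*} [Ring R] [Algebra ℝ R] (_σ : R →ₐ[ℝ] R) : Type _ := R × R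

namespace OddExt

variable {R : Type*} [Ring R] [Algebra ℝ R] {σ : R →ₐ[ℝ] R}

instance : AddCommGroup (OddExt σ) := inferInstanceAs (AddCommGroup (R × R))

instance : Module ℝ (OddExt σ) := inferInstanceAs (Module ℝ (R × R))

/-- The component `a` of `a + θ b`, that is, the value at `θ = 0`. -/
def body : OddExt σ →ₗ[ℝ] R := LinearMap.fst ℝ R R

/-- The component `b` of `a + θ b`, that is, the derivative `∂_θ` at `θ = 0`. -/
def soul : OddExt σ →ₗ[ℝ] R := LinearMap.snd ℝ R R

/-- The element `a + θ b`. -/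
def mk (a b : R) : OddExt σ := (a, b)

@[simp] theorem body_mk (a b : R) : body (mk a b : OddExt σ) = a := rfl

@[simp] theorem soul_mk (a b : R) : soul (mk a b : OddExt σ) = b := rfl

@[ext] theorem ext {x y : OddExt σ} (h : body x = body y) (h' : soul x = soul y) : x = y :=
  Prod.ext h h'

instance : Mul (OddExt σ) :=
  ⟨fun x y => mk (body x * body y) (soul x * body y + σ (body x) * soul y)⟩

instance : One (OddExt σ) := ⟨mk 1 0⟩

@[simp] theorem body_mul (x y : OddExt σ) : body (x * y) = body x * body y := rfl

@[simp] theorem soul_mul (x y : OddExt σ) :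
    soul (x * y) = soul x * body y + σ (body x) * soul y := rfl

@[simp] theorem body_one : body (1 : OddExt σ) = 1 := rfl

@[simp] theorem soul_one : soul (1 : OddExt σ) = 0 := rfl

instance : Ring (OddExt σ) :=
  { (inferInstance : AddCommGroup (OddExt σ)), (inferInstance : Mul (OddExt σ)),
    (inferInstance : One (OddExt σ)) with
    left_distrib := fun x y z => by ext <;> simp [mul_add]; abel
    right_distrib := fun x y z => by ext <;> simp [add_mul]; abel
    zero_mul := fun x => by ext <;> simp
    mul_zero := fun x => by ext <;> simp
    mul_assoc := fun x y z => by ext <;> simp [mul_assoc, mul_add, add_mul, add_assoc]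
    one_mul := fun x => by ext <;> simp
    mul_one := fun x => by ext <;> simp }

instance : Algebra ℝ (OddExt σ) :=
  Algebra.ofModule (fun r x y => by ext <;> simp) (fun r x y => by ext <;> simp)

end OddExt

/-! ## Test algebras -/

/-- Functions on a test object of the functor of points: a `ℤ`-graded commutative algebra
(negative degrees allowed) whose homogeneous pieces are finite dimensional. -/
structure TestAlg extends GrAlg.{v} where
  finite : ∀ i, FiniteDimensional ℝ (gr i)

/-- The homogeneous pieces of `Λ[τ]`, where `τ` has degree `-1`. -/
def TestAlg.extGr (Λ : TestAlg.{v}) (i : ℤ) : Submodule ℝ (OddExt Λ.parity) :=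
  (Λ.gr i).comap OddExt.body ⊓ (Λ.gr (i + 1)).comap OddExt.soul

theorem TestAlg.mem_extGr {Λ : TestAlg.{v}} {i : ℤ} {x : OddExt Λ.parity} :
    x ∈ Λ.extGr i ↔ OddExt.body x ∈ Λ.gr i ∧ OddExt.soul x ∈ Λ.gr (i + 1) := Iff.rfl

instance TestAlg.extGradedMonoid (Λ : TestAlg.{v}) : SetLike.GradedMonoid Λ.extGr where
  one_mem := ⟨SetLike.one_mem_graded Λ.gr, by simp⟩
  mul_mem := by
    intro i j x y hx hy
    rw [TestAlg.mem_extGr] at *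
    refine ⟨SetLike.mul_mem_graded hx.1 hy.1, ?_⟩
    have h1 := SetLike.mul_mem_graded hx.2 hy.1
    have h2 := SetLike.mul_mem_graded hx.1 hy.2
    rw [OddExt.soul_mul, Λ.parity_of_mem hx.1, smul_mul_assoc]
    refine Submodule.add_mem _ ?_ (Submodule.smul_mem _ _ ?_)
    · convert h1 using 2; ring
    · convert h2 using 2; ring

/-- The inclusion `a ↦ a` of `Λ` into `Λ[τ]`. -/
def TestAlg.inl (Λ : TestAlg.{v}) : Λ.carrier →ₐ[ℝ] OddExt Λ.parity :=
  AlgHom.ofLinearMap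
    { toFun := fun a => OddExt.mk a 0
      map_add' := fun a b => by ext <;> simp
      map_smul' := fun r a => by ext <;> simp }
    rfl (fun a b => by ext <;> simp)

/-- The map `b ↦ τ b` from `Λ` to `Λ[τ]`. -/
def TestAlg.inr (Λ : TestAlg.{v}) : Λ.carrier →ₗ[ℝ] OddExt Λ.parity where
  toFun b := OddExt.mk 0 b
  map_add' a b := by ext <;> simp
  map_smul' r a := by ext <;> simp

section

variable (Λ : TestAlg.{v})

@[simp] theorem TestAlg.body_inl (a : Λ.carrier) : OddExt.body (Λ.inl a) = a := rfl
@[simp] theorem TestAlg.soul_inl (a : Λ.carrier) : OddExt.soul (Λ.inl a) = 0 := rfl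
@[simp] theorem TestAlg.body_inr (a : Λ.carrier) : OddExt.body (Λ.inr a) = 0 := rfl
@[simp] theorem TestAlg.soul_inr (a : Λ.carrier) : OddExt.soul (Λ.inr a) = a := rfl

theorem TestAlg.inl_mem {i : ℤ} {a : Λ.carrier} (ha : a ∈ Λ.gr i) : Λ.inl a ∈ Λ.extGr i :=
  TestAlg.mem_extGr.2 ⟨by simpa, by simp⟩

theorem TestAlg.inr_mem {i : ℤ} {a : Λ.carrier} (ha : a ∈ Λ.gr (i + 1)) :
    Λ.inr a ∈ Λ.extGr i :=
  TestAlg.mem_extGr.2 ⟨by simp, by simpa⟩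

/-- The decomposition of `Λ[τ]` into homogeneous pieces. -/
def TestAlg.extDecompose : OddExt Λ.parity →ₗ[ℝ] DirectSum ℤ (fun i => Λ.extGr i) :=
  (DirectSum.toModule ℝ ℤ _ (fun i => DirectSum.lof ℝ ℤ (fun i => Λ.extGr i) i ∘ₗ
      ((Λ.inl.toLinearMap ∘ₗ (Λ.gr i).subtype).codRestrict _
        (fun a => Λ.inl_mem a.2)))) ∘ₗ
    (DirectSum.decomposeLinearEquiv Λ.gr).toLinearMap ∘ₗ OddExt.body +
  (DirectSum.toModule ℝ ℤ _ (fun i => DirectSum.lof ℝ ℤ (fun i => Λ.extGr i) (i - 1) ∘ₗ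
      ((Λ.inr ∘ₗ (Λ.gr i).subtype).codRestrict _
        (fun a => Λ.inr_mem (by simp))))) ∘ₗ
    (DirectSum.decomposeLinearEquiv Λ.gr).toLinearMap ∘ₗ OddExt.soul

theorem TestAlg.lof_congr {i j : ℤ} (h : i = j) (x : Λ.extGr i) (y : Λ.extGr j)
    (hxy : (x : OddExt Λ.parity) = y) :
    DirectSum.lof ℝ ℤ (fun i => Λ.extGr i) i x = DirectSum.lof ℝ ℤ (fun i => Λ.extGr i) j y := by
  subst h
  congr 1
  exact Subtype.ext hxy

theorem TestAlg.extDecompose_coe {i : ℤ} (x : Λ.extGr i) :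
    Λ.extDecompose (x : OddExt Λ.parity) = DirectSum.lof ℝ ℤ (fun i => Λ.extGr i) i x := by
  obtain ⟨x, hb, hs⟩ := x
  obtain ⟨a, ha⟩ : ∃ a : Λ.gr i, (a : Λ.carrier) = OddExt.body x := ⟨⟨_, hb⟩, rfl⟩
  obtain ⟨b, hb'⟩ : ∃ b : Λ.gr (i + 1), (b : Λ.carrier) = OddExt.soul x := ⟨⟨_, hs⟩, rfl⟩
  have hx : x = Λ.inl a + Λ.inr b := by ext <;> simp [ha, hb']
  simp only [TestAlg.extDecompose, LinearMap.add_apply, LinearMap.comp_apply, ← ha, ← hb',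
    LinearEquiv.coe_coe, DirectSum.decomposeLinearEquiv_apply_coe, DirectSum.toModule_lof]
  rw [Λ.lof_congr (show i + 1 - 1 = i by ring) _ ⟨Λ.inr b, Λ.inr_mem b.2⟩ rfl, ← map_add]
  exact Λ.lof_congr rfl _ _ hx.symm

theorem TestAlg.coe_extDecompose (x : OddExt Λ.parity) :
    DirectSum.coeLinearMap Λ.extGr (Λ.extDecompose x) = x := by
  have h1 : ∀ a : Λ.carrier, DirectSum.coeLinearMap Λ.extGr (Λ.extDecompose (Λ.inl a)) =
      Λ.inl a := fun a => by
    refine DirectSum.Decomposition.inductionOn Λ.gr (motive := fun a =>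
      DirectSum.coeLinearMap Λ.extGr (Λ.extDecompose (Λ.inl a)) = Λ.inl a) ?_ ?_ ?_ a
    · simp
    · intro i a
      have := Λ.extDecompose_coe ⟨Λ.inl a, Λ.inl_mem a.2⟩
      simp only at this
      rw [this, DirectSum.coeLinearMap_lof]
    · intro a b ha hb
      simp only [map_add, ha, hb]
  have h2 : ∀ a : Λ.carrier, DirectSum.coeLinearMap Λ.extGr (Λ.extDecompose (Λ.inr a)) =
      Λ.inr a := fun a => by
    refine DirectSum.Decomposition.inductionOn Λ.gr (motive := fun a =>
      DirectSum.coeLinearMap Λ.extGr (Λ.extDecompose (Λ.inr a)) = Λ.inr a) ?_ ?_ ?_ a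
    · simp
    · intro i a
      have := Λ.extDecompose_coe (i := i - 1) ⟨Λ.inr a, Λ.inr_mem (by simp)⟩
      simp only at this
      rw [this, DirectSum.coeLinearMap_lof]
    · intro a b ha hb
      simp only [map_add, ha, hb]
  have hx : x = Λ.inl (OddExt.body x) + Λ.inr (OddExt.soul x) := by ext <;> simp
  rw [hx, map_add, map_add, h1, h2]

instance TestAlg.extGradedAlgebra : GradedAlgebra Λ.extGr :=
  { Λ.extGradedMonoid, DirectSum.Decomposition.ofLinearMap Λ.extGr Λ.extDecompose
      (LinearMap.ext Λ.coe_extDecompose)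
      (DirectSum.linearMap_ext _ fun i => LinearMap.ext fun x => by
        simp only [LinearMap.comp_apply, DirectSum.coeLinearMap_lof, LinearMap.id_apply]
        exact Λ.extDecompose_coe x) with }

theorem TestAlg.neg_one_zpow_even (n : ℤ) : (-1 : ℝ) ^ (n + n) = 1 := by
  rw [zpow_add₀ (by norm_num), neg_one_sq_zpow]

/-- The test algebra `Λ[τ]`, with `τ` of degree `-1` and `τ ^ 2 = 0`; the pair `(a, b)` stands for
`a + τ b`. -/
def TestAlg.ext : TestAlg.{v} where
  carrier := OddExt Λ.parity
  gr := Λ.extGr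
  comm := by
    intro i j x y hx hy
    rw [TestAlg.mem_extGr] at hx hy
    have hs : (-1 : ℝ) ^ i = (-1) ^ (i * j) * (-1) ^ (i * (j + 1)) := by
      rw [← zpow_add₀ (by norm_num), show i * j + i * (j + 1) = (i * j + i * j) + i by ring,
        zpow_add₀ (by norm_num), neg_one_zpow_even, one_mul]
    have hs' : (-1 : ℝ) ^ ((i + 1) * j) = (-1) ^ (i * j) * (-1) ^ j := by
      rw [← zpow_add₀ (by norm_num)]; congr 1; ring
    have hs'' : (-1 : ℝ) ^ i * (-1) ^ (i * (j + 1)) = (-1) ^ (i * j) := by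
      rw [hs, mul_assoc, neg_one_sq_zpow, mul_one]
    ext
    · simpa using Λ.comm hx.1 hy.1
    · rw [OddExt.soul_mul, map_smul, OddExt.soul_mul, Λ.parity_of_mem hx.1, Λ.parity_of_mem hy.1,
        Λ.comm hx.2 hy.1, smul_mul_assoc, Λ.comm hx.1 hy.2, smul_mul_assoc, smul_add, smul_smul,
        smul_smul, hs', hs'', add_comm]
  finite := by
    intro i
    have := Λ.finite i
    have := Λ.finite (i + 1)
    refine Module.Finite.of_injective
      (((OddExt.body ∘ₗ (Λ.extGr i).subtype).codRestrict (Λ.gr i) (fun x => x.2.1)).prod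
        ((OddExt.soul ∘ₗ (Λ.extGr i).subtype).codRestrict (Λ.gr (i + 1)) (fun x => x.2.2))) ?_
    intro x y hxy
    have hxy := Prod.mk.inj hxy
    exact Subtype.ext (OddExt.ext (congrArg Subtype.val hxy.1) (congrArg Subtype.val hxy.2))

/-- The inclusion `Λ → Λ[τ]`, `a ↦ a`. -/
def TestAlg.extInl : Λ.carrier →ₐ[ℝ] Λ.ext.carrier := Λ.inl

/-- The map `Λ → Λ[τ]`, `b ↦ τ b`. -/
def TestAlg.extInr : Λ.carrier →ₗ[ℝ] Λ.ext.carrier where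
  toFun := Λ.inr
  map_add' := map_add Λ.inr
  map_smul' := map_smul Λ.inr

/-- The coefficient `b` of `τ` in `a + τ b`. -/
def TestAlg.extSoul : Λ.ext.carrier →ₗ[ℝ] Λ.carrier where
  toFun x := OddExt.soul (σ := Λ.parity) x
  map_add' := map_add (OddExt.soul (σ := Λ.parity))
  map_smul' := map_smul (OddExt.soul (σ := Λ.parity))

theorem TestAlg.extInl_mem {i : ℤ} {a : Λ.carrier} (ha : a ∈ Λ.gr i) :
    Λ.extInl a ∈ Λ.ext.gr i := Λ.inl_mem ha

theorem TestAlg.extInr_mem {i : ℤ} {a : Λ.carrier} (ha : a ∈ Λ.gr (i + 1)) :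
    Λ.extInr a ∈ Λ.ext.gr i := Λ.inr_mem ha

end

/-! ## Smooth functions on the unit interval -/

/-- The algebra of smooth functions on `[0, 1]`, as a subalgebra of all functions. -/
def smoothSubalgebra : Subalgebra ℝ (unitInterval → ℝ) where
  carrier := {g | ContDiffOn ℝ ∞ (Set.IccExtend zero_le_one g) (Set.Icc 0 1)}
  mul_mem' := fun hf hg => ContDiffOn.mul hf hg
  add_mem' := fun hf hg => ContDiffOn.add hf hg
  algebraMap_mem' := fun _ => contDiffOn_const

/-- The algebra of smooth functions on `[0, 1]`. -/
def SmoothI : Type := smoothSubalgebra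

namespace SmoothI

instance : CommRing SmoothI := inferInstanceAs (CommRing smoothSubalgebra)

instance : Algebra ℝ SmoothI := inferInstanceAs (Algebra ℝ smoothSubalgebra)

instance : CoeFun SmoothI (fun _ => unitInterval → ℝ) := ⟨fun g => g.1⟩

@[ext] theorem ext {f g : SmoothI} (h : ∀ t, f t = g t) : f = g := Subtype.ext (funext h)

/-- The extension of a smooth function to the real line, constant outside of `[0, 1]`. -/
def extend (g : SmoothI) : ℝ → ℝ := Set.IccExtend zero_le_one g

@[simp] theorem extend_coe (g : SmoothI) (t : unitInterval) : g.extend t = g t :=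
  Set.IccExtend_val _ _ t

theorem contDiffOn (g : SmoothI) : ContDiffOn ℝ ∞ g.extend (Set.Icc 0 1) := g.2

theorem differentiableWithinAt (g : SmoothI) (t : unitInterval) :
    DifferentiableWithinAt ℝ g.extend (Set.Icc 0 1) t :=
  g.contDiffOn.differentiableOn (by simp) t t.2

theorem continuous_extend (g : SmoothI) : Continuous g.extend := by
  refine Continuous.Icc_extend' ?_
  have := continuousOn_iff_continuous_domRestrict.1 g.contDiffOn.continuousOn
  exact this.congr fun t => g.extend_coe t

/-- The restriction to `[0, 1]` of a function which is smooth there. -/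
def ofContDiffOn (G : ℝ → ℝ) (hG : ContDiffOn ℝ ∞ G (Set.Icc 0 1)) : SmoothI :=
  ⟨fun t => G t, hG.congr fun _ ht => Set.IccExtend_of_mem _ _ ht⟩

@[simp] theorem ofContDiffOn_apply (G : ℝ → ℝ) (hG : ContDiffOn ℝ ∞ G (Set.Icc 0 1))
    (t : unitInterval) : ofContDiffOn G hG t = G t := rfl

/-- The derivative `d/dt` (one-sided at the end points). -/
def deriv : SmoothI →ₗ[ℝ] SmoothI where
  toFun g := ofContDiffOn (derivWithin g.extend (Set.Icc 0 1))
    (g.contDiffOn.derivWithin (uniqueDiffOn_Icc zero_lt_one) (by simp))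
  map_add' f g := by
    ext t
    exact derivWithin_add (f.differentiableWithinAt t) (g.differentiableWithinAt t)
  map_smul' r f := by
    ext t
    exact derivWithin_const_smul r (f.differentiableWithinAt t)

theorem deriv_mul (f g : SmoothI) : deriv (f * g) = deriv f * g + f * deriv g := by
  ext t
  have := derivWithin_mul (f.differentiableWithinAt t) (g.differentiableWithinAt t)
  rw [extend_coe, extend_coe] at this
  exact this

theorem hasDerivAt_integral (g : SmoothI) (s : unitInterval) (t : ℝ) :
    HasDerivAt (fun t : ℝ => ∫ r in (s : ℝ)..t, g.extend r) (g.extend t) t :=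
  intervalIntegral.integral_hasDerivAt_right (g.continuous_extend.intervalIntegrable _ _)
    (g.continuous_extend.stronglyMeasurableAtFilter _ _) g.continuous_extend.continuousAt

/-- The primitive `t ↦ ∫_s^t g`. -/
def integral (s : unitInterval) : SmoothI →ₗ[ℝ] SmoothI where
  toFun g := ofContDiffOn (fun t => ∫ r in (s : ℝ)..t, g.extend r) (by
    rw [contDiffOn_infty_iff_derivWithin (uniqueDiffOn_Icc zero_lt_one)]
    refine ⟨fun t _ => (g.hasDerivAt_integral s t).differentiableAt.differentiableWithinAt,
      g.contDiffOn.congr fun t ht => ?_⟩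
    exact (g.hasDerivAt_integral s t).hasDerivWithinAt.derivWithin
      (uniqueDiffOn_Icc zero_lt_one t ht))
  map_add' f g := by
    ext t
    exact intervalIntegral.integral_add (f.continuous_extend.intervalIntegrable _ _)
      (g.continuous_extend.intervalIntegrable _ _)
  map_smul' r f := by
    ext t
    exact intervalIntegral.integral_smul r _

/-- Evaluation at `t`. -/
def eval (t : unitInterval) : SmoothI →ₐ[ℝ] ℝ :=
  (Pi.evalAlgHom ℝ (fun _ => ℝ) t).comp smoothSubalgebra.val

@[simp] theorem eval_apply (t : unitInterval) (g : SmoothI) : eval t g = g t := rfl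

end SmoothI

/-! ## Functions on `T[1][0,1] × L` -/

section

variable (G : GrAlg.{u})

/-- Smooth functions of `t ∈ [0, 1]` with values in the algebra `G`. -/
abbrev PathAlg : Type u := SmoothI ⊗[ℝ] G.carrier

/-- The part of degree `i` (the coordinate `t` has degree `0`). -/
def pathGr (i : ℤ) : Submodule ℝ (PathAlg G) :=
  LinearMap.range (LinearMap.lTensor SmoothI (G.gr i).subtype)

/-- Evaluation at the time `t`. -/
def evalAt (t : unitInterval) : PathAlg G →ₐ[ℝ] G.carrier :=
  (Algebra.TensorProduct.lid ℝ G.carrier).toAlgHom.comp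
    (Algebra.TensorProduct.map (SmoothI.eval t) (AlgHom.id ℝ G.carrier))

/-- The derivative `∂_t`. -/
def dt : PathAlg G →ₗ[ℝ] PathAlg G := LinearMap.rTensor G.carrier SmoothI.deriv

/-- The primitive `t ↦ ∫_s^t`. -/
def primitive (s : unitInterval) : PathAlg G →ₗ[ℝ] PathAlg G :=
  LinearMap.rTensor G.carrier (SmoothI.integral s)

/-- The parity involution of `PathAlg G`. -/
def pathParity : PathAlg G →ₐ[ℝ] PathAlg G :=
  Algebra.TensorProduct.map (AlgHom.id ℝ SmoothI) G.parity

/-- Functions on `T[1][0,1] × L`: superfields `f(t) + θ f_θ(t)`, with `θ` odd of degree `1`. -/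
abbrev SuperAlg : Type u := OddExt (R := PathAlg G) (pathParity G)

end

/-! ## NQ-manifolds, representations and super-curves -/

/-- The algebra of functions of (a patch of) an NQ-manifold: a non-negatively graded commutative
algebra with a derivation `Q` of degree `1` and square zero. -/
structure NQAlg extends GrAlg.{u} where
  nonneg : ∀ i < 0, gr i = ⊥
  Q : carrier →ₗ[ℝ] carrier
  Q_mem : ∀ {i : ℤ} {f : carrier}, f ∈ gr i → Q f ∈ gr (i + 1)
  Q_mul : ∀ {i : ℤ} {f : carrier}, f ∈ gr i → ∀ g,
    Q (f * g) = Q f * g + (-1 : ℝ) ^ i • (f * Q g)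
  Q_sq : ∀ f, Q (Q f) = 0

/-- A representation of `Q` in a trivialization: a bundle with fibre coordinates `ζ_α` of degree
(level) `lev α` and the normalized matrix `T` of the lift
`Q̂ ζ_α = ∑ β, (-1)^β ζ_β T^β_α`; the equation `flat` says `Q̂² = 0`. -/
structure QRep (M : NQAlg.{u}) (ι : Type) [Fintype ι] where
  lev : ι → ℤ
  T : Matrix ι ι M.carrier
  T_mem : ∀ α β, T α β ∈ M.gr (lev β - lev α + 1)
  flat : ∀ β α, (-1 : ℝ) ^ lev β • M.Q (T β α) +
    ∑ γ, (-1 : ℝ) ^ lev γ • (T β γ * T γ α) = 0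

/-- The variation `δ_ε T^β_α = Q ε^β_α + T^β_γ ε^γ_α - (-1)^(β+γ) ε^β_γ T^γ_α` under the
infinitesimal change of trivialization `ζ_α ↦ ζ_α + ζ_β ε^β_α`. -/
def QRep.deltaT {M : NQAlg.{u}} {ι : Type} [Fintype ι] (E : QRep M ι)
    (ε : Matrix ι ι M.carrier) : Matrix ι ι M.carrier :=
  Matrix.of fun β α => M.Q (ε β α) + ∑ γ, E.T β γ * ε γ α -
    ∑ γ, (-1 : ℝ) ^ (E.lev β + E.lev γ) • (ε β γ * E.T γ α)

/-- An `L`-family of super-curves `T[1][0,1] × L → M`, where `Λ` is the algebra of functions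
on `L`: a morphism of graded algebras in the opposite direction. No compatibility with `Q` is
required, and components of negative degree (auxiliary fields) are kept. -/
structure SuperCurve (M : NQAlg.{u}) (Λ : TestAlg.{v}) where
  toHom : M.carrier →ₐ[ℝ] SuperAlg Λ.toGrAlg
  body_mem : ∀ {i f}, f ∈ M.gr i → OddExt.body (toHom f) ∈ pathGr Λ.toGrAlg i
  soul_mem : ∀ {i f}, f ∈ M.gr i → OddExt.soul (toHom f) ∈ pathGr Λ.toGrAlg (i - 1)

namespace SuperCurve

variable {M : NQAlg.{u}} {Λ : TestAlg.{v}} (φ : SuperCurve M Λ)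

/-- The component of the superfield `f` without `θ`, as a function of `t`. -/
def fld (f : M.carrier) : PathAlg Λ.toGrAlg := OddExt.body (φ.toHom f)

/-- The derivative `∂_θ` of the superfield `f`, as a function of `t`. -/
def dtheta (f : M.carrier) : PathAlg Λ.toGrAlg := OddExt.soul (φ.toHom f)

/-- The value `f(t)` of the superfield `f` at time `t` and `θ = 0`. -/
def value (t : unitInterval) (f : M.carrier) : Λ.carrier := evalAt Λ.toGrAlg t (φ.fld f)

end SuperCurve

/-! ## The BRST differential -/

section shift

theorem pathParity_of_mem {G : GrAlg.{u}} {i : ℤ} {p : PathAlg G} (hp : p ∈ pathGr G i) :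
    pathParity G p = (-1 : ℝ) ^ i • p := by
  obtain ⟨x, rfl⟩ := hp
  induction x using TensorProduct.induction_on with
  | zero => simp
  | add x y hx hy => simp only [map_add, hx, hy, smul_add]
  | tmul g a => simp [pathParity, G.parity_of_mem a.2]

theorem lTensor_mem {G H : GrAlg} {i j : ℤ} (h : G.carrier →ₗ[ℝ] H.carrier)
    (hh : ∀ a ∈ G.gr i, h a ∈ H.gr j) {p : PathAlg G} (hp : p ∈ pathGr G i) :
    LinearMap.lTensor SmoothI h p ∈ pathGr H j := by
  obtain ⟨x, rfl⟩ := hp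
  induction x using TensorProduct.induction_on with
  | zero => simp
  | add x y hx hy =>
    rw [map_add, map_add]
    exact Submodule.add_mem _ hx hy
  | tmul g a =>
    simp only [LinearMap.lTensor_tmul]
    exact ⟨g ⊗ₜ ⟨h a, hh a a.2⟩, by simp⟩

theorem dt_mem {G : GrAlg.{u}} {i : ℤ} {p : PathAlg G} (hp : p ∈ pathGr G i) :
    dt G p ∈ pathGr G i := by
  obtain ⟨x, rfl⟩ := hp
  induction x using TensorProduct.induction_on with
  | zero => simp
  | add x y hx hy =>
    rw [map_add, map_add]
    exact Submodule.add_mem _ hx hy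
  | tmul g a => exact ⟨SmoothI.deriv g ⊗ₜ a, by simp [dt]⟩

theorem dt_mul {G : GrAlg.{u}} (p q : PathAlg G) : dt G (p * q) = dt G p * q + p * dt G q := by
  induction p using TensorProduct.induction_on with
  | zero => simp
  | add x y hx hy =>
    simp only [add_mul, map_add, hx, hy]
    abel
  | tmul f a =>
    induction q using TensorProduct.induction_on with
    | zero => simp
    | add x y hx hy =>
      simp only [mul_add, map_add, hx, hy]
      abel
    | tmul g b => simp [dt, SmoothI.deriv_mul, TensorProduct.add_tmul]

variable (Λ : TestAlg.{v})

/-- The inclusion of `Λ`-valued paths into `Λ[τ]`-valued ones. -/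
def pathInl : PathAlg Λ.toGrAlg →ₗ[ℝ] PathAlg Λ.ext.toGrAlg :=
  LinearMap.lTensor SmoothI Λ.extInl.toLinearMap

/-- Multiplication by `τ` from the left, from `Λ`-valued to `Λ[τ]`-valued paths. -/
def pathInr : PathAlg Λ.toGrAlg →ₗ[ℝ] PathAlg Λ.ext.toGrAlg :=
  LinearMap.lTensor SmoothI Λ.extInr

theorem parity_inl (a : Λ.carrier) : Λ.ext.parity (Λ.extInl a) = Λ.extInl (Λ.parity a) := by
  refine DirectSum.Decomposition.inductionOn Λ.gr (motive := fun a =>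
    Λ.ext.parity (Λ.extInl a) = Λ.extInl (Λ.parity a)) ?_ ?_ ?_ a
  · simp
  · intro i a
    rw [Λ.parity_of_mem a.2, Λ.ext.parity_of_mem (Λ.extInl_mem a.2), map_smul]
  · intro a b ha hb
    simp only [map_add, ha, hb]

theorem parity_inr (a : Λ.carrier) : Λ.ext.parity (Λ.extInr a) = -Λ.extInr (Λ.parity a) := by
  refine DirectSum.Decomposition.inductionOn Λ.gr (motive := fun a =>
    Λ.ext.parity (Λ.extInr a) = -Λ.extInr (Λ.parity a)) ?_ ?_ ?_ a
  · simp
  · intro i a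
    rw [Λ.parity_of_mem a.2, Λ.ext.parity_of_mem (Λ.extInr_mem (i := i - 1) (by simp)), map_smul,
      zpow_sub_one₀ (by norm_num)]
    simp
  · intro a b ha hb
    simp only [map_add, ha, hb, neg_add]

theorem inl_mul_inr (a b : Λ.carrier) :
    Λ.extInl a * Λ.extInr b = Λ.extInr (Λ.parity a * b) :=
  show Λ.inl a * Λ.inr b = Λ.inr (Λ.parity a * b) by ext <;> simp

theorem inr_mul_inl (a b : Λ.carrier) : Λ.extInr a * Λ.extInl b = Λ.extInr (a * b) :=
  show Λ.inr a * Λ.inl b = Λ.inr (a * b) by ext <;> simp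

theorem inr_mul_inr (a b : Λ.carrier) : Λ.extInr a * Λ.extInr b = 0 :=
  show Λ.inr a * Λ.inr b = 0 by ext <;> simp

/-- To check an identity which is additive in two paths, check it on elementary tensors. -/
theorem path_induction₂ {P : PathAlg Λ.toGrAlg → PathAlg Λ.toGrAlg → Prop}
    (zl : ∀ q, P 0 q) (zr : ∀ p, P p 0)
    (al : ∀ p p' q, P p q → P p' q → P (p + p') q)
    (ar : ∀ p q q', P p q → P p q' → P p (q + q'))
    (t : ∀ f a g b, P (f ⊗ₜ a) (g ⊗ₜ b)) (p q : PathAlg Λ.toGrAlg) : P p q := by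
  induction p using TensorProduct.induction_on with
  | zero => exact zl q
  | add x y hx hy => exact al x y q hx hy
  | tmul f a =>
    induction q using TensorProduct.induction_on with
    | zero => exact zr _
    | add x y hx hy => exact ar _ x y hx hy
    | tmul g b => exact t f a g b

theorem pathInl_mul (p q : PathAlg Λ.toGrAlg) :
    pathInl Λ p * pathInl Λ q = pathInl Λ (p * q) := by
  induction p, q using path_induction₂ with
  | zl q => simp
  | zr q => simp
  | al p p' q h h' => simp only [map_add, add_mul, h, h']
  | ar p p' q h h' => simp only [map_add, mul_add, h, h']
  | t f a g b =>
    simp only [pathInl, LinearMap.lTensor_tmul, Algebra.TensorProduct.tmul_mul_tmul]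
    exact congrArg _ (map_mul Λ.extInl a b).symm

theorem pathInl_mul_pathInr (p q : PathAlg Λ.toGrAlg) :
    pathInl Λ p * pathInr Λ q = pathInr Λ (pathParity Λ.toGrAlg p * q) := by
  induction p, q using path_induction₂ with
  | zl q => simp
  | zr q => simp
  | al p p' q h h' => simp only [map_add, add_mul, h, h']
  | ar p p' q h h' => simp only [map_add, mul_add, h, h']
  | t f a g b =>
    simp only [pathInl, pathInr, pathParity, LinearMap.lTensor_tmul,
      Algebra.TensorProduct.tmul_mul_tmul, Algebra.TensorProduct.map_tmul, AlgHom.id_apply]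
    exact congrArg _ (inl_mul_inr Λ a b)

theorem pathInr_mul_pathInl (p q : PathAlg Λ.toGrAlg) :
    pathInr Λ p * pathInl Λ q = pathInr Λ (p * q) := by
  induction p, q using path_induction₂ with
  | zl q => simp
  | zr q => simp
  | al p p' q h h' => simp only [map_add, add_mul, h, h']
  | ar p p' q h h' => simp only [map_add, mul_add, h, h']
  | t f a g b =>
    simp only [pathInl, pathInr, LinearMap.lTensor_tmul, Algebra.TensorProduct.tmul_mul_tmul]
    exact congrArg _ (inr_mul_inl Λ a b)

theorem pathInr_mul_pathInr (p q : PathAlg Λ.toGrAlg) :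
    pathInr Λ p * pathInr Λ q = 0 := by
  induction p, q using path_induction₂ with
  | zl q => simp
  | zr q => simp
  | al p p' q h h' => simp only [map_add, add_mul, h, h', add_zero]
  | ar p p' q h h' => simp only [map_add, mul_add, h, h', add_zero]
  | t f a g b =>
    simp only [pathInr, LinearMap.lTensor_tmul, Algebra.TensorProduct.tmul_mul_tmul]
    rw [inr_mul_inr, TensorProduct.tmul_zero]

theorem pathParity_pathInl (p : PathAlg Λ.toGrAlg) :
    pathParity Λ.ext.toGrAlg (pathInl Λ p) = pathInl Λ (pathParity Λ.toGrAlg p) := by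
  induction p using TensorProduct.induction_on with
  | zero => simp
  | add x y hx hy => simp only [map_add, hx, hy]
  | tmul f a =>
    simp only [pathInl, pathParity, LinearMap.lTensor_tmul, Algebra.TensorProduct.map_tmul]
    exact congrArg _ (parity_inl Λ a)

theorem pathParity_pathInr (p : PathAlg Λ.toGrAlg) :
    pathParity Λ.ext.toGrAlg (pathInr Λ p) = -pathInr Λ (pathParity Λ.toGrAlg p) := by
  induction p using TensorProduct.induction_on with
  | zero => simp
  | add x y hx hy => simp only [map_add, hx, hy, neg_add]
  | tmul f a =>
    simp only [pathInr, pathParity, LinearMap.lTensor_tmul, Algebra.TensorProduct.map_tmul]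
    rw [parity_inr, TensorProduct.tmul_neg]

variable {Λ} {M : NQAlg.{u}}

theorem SuperCurve.fld_mul (φ : SuperCurve M Λ) (f g : M.carrier) :
    φ.fld (f * g) = φ.fld f * φ.fld g := by
  simp [SuperCurve.fld]

theorem SuperCurve.dtheta_mul (φ : SuperCurve M Λ) {i : ℤ} {f : M.carrier} (hf : f ∈ M.gr i)
    (g : M.carrier) : φ.dtheta (f * g) =
      φ.dtheta f * φ.fld g + (-1 : ℝ) ^ i • (φ.fld f * φ.dtheta g) := by
  simp only [SuperCurve.dtheta, SuperCurve.fld, map_mul, OddExt.soul_mul,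
    pathParity_of_mem (φ.body_mem hf), smul_mul_assoc]

/-- The superfields of the shifted curve, see `SuperCurve.shift`. -/
def SuperCurve.shiftLin (φ : SuperCurve M Λ) : M.carrier →ₗ[ℝ] SuperAlg Λ.ext.toGrAlg where
  toFun f := OddExt.mk (pathInl Λ (φ.fld f) + pathInr Λ (φ.fld (M.Q f)))
    (pathInl Λ (φ.dtheta f) -
      pathInr Λ (φ.dtheta (M.Q f) - dt Λ.toGrAlg (φ.fld f)))
  map_add' f g := by
    ext
    · simp only [SuperCurve.fld, map_add, OddExt.body_mk]; abel
    · simp only [SuperCurve.fld, SuperCurve.dtheta, map_add, map_sub, OddExt.soul_mk]; abel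
  map_smul' r f := by
    ext
    · simp only [SuperCurve.fld, map_smul, OddExt.body_mk, smul_add, RingHom.id_apply]
    · simp only [SuperCurve.fld, SuperCurve.dtheta, map_smul, map_sub, OddExt.soul_mk, smul_sub,
        RingHom.id_apply]

theorem SuperCurve.shiftLin_mul (φ : SuperCurve M Λ) (f g : M.carrier) :
    φ.shiftLin (f * g) = φ.shiftLin f * φ.shiftLin g := by
  refine DirectSum.Decomposition.inductionOn M.gr (motive := fun f =>
    φ.shiftLin (f * g) = φ.shiftLin f * φ.shiftLin g) ?_ ?_ ?_ f
  · simp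
  · intro i f
    obtain ⟨f, hf⟩ := f
    simp only
    have h0 := pathParity_of_mem (φ.body_mem hf)
    have h1 := pathParity_of_mem (φ.soul_mem hf)
    have h2 := pathParity_of_mem (φ.body_mem (M.Q_mem hf))
    have hs : ((-1 : ℝ) ^ i) * (-1) ^ i = 1 := neg_one_sq_zpow i
    have e1 : (-1 : ℝ) ^ (i - 1) = -(-1) ^ i := by rw [zpow_sub_one₀ (by norm_num)]; simp
    have e2 : (-1 : ℝ) ^ (i + 1) = -(-1) ^ i := by rw [zpow_add_one₀ (by norm_num)]; simp
    change pathParity _ (φ.fld f) = _ • φ.fld f at h0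
    change pathParity _ (φ.dtheta f) = _ • φ.dtheta f at h1
    change pathParity _ (φ.fld (M.Q f)) = _ • φ.fld (M.Q f) at h2
    rw [e1] at h1
    rw [e2] at h2
    have k1 : φ.fld (M.Q f * g + (-1 : ℝ) ^ i • (f * M.Q g)) =
        φ.fld (M.Q f) * φ.fld g + (-1 : ℝ) ^ i • (φ.fld f * φ.fld (M.Q g)) := by
      simp [SuperCurve.fld]
    have k2 : φ.dtheta (M.Q f * g + (-1 : ℝ) ^ i • (f * M.Q g)) =
        φ.dtheta (M.Q f * g) + (-1 : ℝ) ^ i • φ.dtheta (f * M.Q g) := by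
      simp only [SuperCurve.dtheta, map_add, map_smul]
    ext
    · simp only [SuperCurve.shiftLin, LinearMap.coe_mk, AddHom.coe_mk, OddExt.body_mk,
        OddExt.body_mul, M.Q_mul hf, k1, φ.fld_mul, add_mul, mul_add, pathInl_mul,
        pathInl_mul_pathInr, pathInr_mul_pathInl, pathInr_mul_pathInr, h0, smul_mul_assoc,
        map_add, map_smul]
      abel
    · simp only [SuperCurve.shiftLin, LinearMap.coe_mk, AddHom.coe_mk, OddExt.body_mk,
        OddExt.soul_mk, OddExt.soul_mul, M.Q_mul hf, k2, φ.fld_mul, φ.dtheta_mul hf,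
        φ.dtheta_mul (M.Q_mem hf), pathParity_pathInl, pathParity_pathInr, add_mul, mul_add,
        sub_mul, mul_sub, pathInl_mul, pathInl_mul_pathInr, pathInr_mul_pathInl,
        pathInr_mul_pathInr, h0, h1, h2, e2, smul_mul_assoc, map_add, map_sub, map_smul, dt_mul,
        smul_add, smul_smul, hs, one_smul, neg_smul, map_neg, neg_mul, neg_neg]
      abel
  · intro f f' hf hf'
    simp only [add_mul, map_add, hf, hf']

theorem NQAlg.Q_one (M : NQAlg.{u}) : M.Q 1 = 0 := by
  have := M.Q_mul (SetLike.one_mem_graded M.gr) 1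
  simpa using this

theorem dt_one (G : GrAlg.{u}) : dt G 1 = 0 := by
  have := dt_mul (1 : PathAlg G) 1
  simpa using this

theorem SuperCurve.shiftLin_one (φ : SuperCurve M Λ) : φ.shiftLin 1 = 1 := by
  have h : pathInl Λ 1 = 1 := by
    change LinearMap.lTensor SmoothI Λ.extInl.toLinearMap (1 ⊗ₜ 1) = 1 ⊗ₜ 1
    rw [LinearMap.lTensor_tmul]
    exact congrArg _ (map_one Λ.extInl)
  ext <;> simp [SuperCurve.shiftLin, SuperCurve.fld, SuperCurve.dtheta, M.Q_one, h, dt_one]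

end shift

/-- The super-curve `φ + τ (Qφ - Dφ)` over `Λ[τ]`, where `D = θ ∂_t`: the infinitesimal flow, with
odd parameter `τ`, of the vector field `δ_B` given by `δ_B x = Q x - D x` on superfields. In
components `f + θ f_θ` this is (as `τ θ = - θ τ`)
`f ↦ f + τ (Qf)` and `f_θ ↦ f_θ - τ ((Qf)_θ - ∂_t f)`. -/
def SuperCurve.shift {M : NQAlg.{u}} {Λ : TestAlg.{v}} (φ : SuperCurve M Λ) :
    SuperCurve M Λ.ext where
  toHom := AlgHom.ofLinearMap φ.shiftLin φ.shiftLin_one φ.shiftLin_mul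
  body_mem := by
    intro i f hf
    refine Submodule.add_mem _ (lTensor_mem _ (fun a ha => Λ.extInl_mem ha) (φ.body_mem hf))
      (lTensor_mem _ (fun a ha => Λ.extInr_mem ha) (φ.body_mem (M.Q_mem hf)))
  soul_mem := by
    intro i f hf
    refine Submodule.sub_mem _ (lTensor_mem _ (fun a ha => Λ.extInl_mem ha) (φ.soul_mem hf))
      (lTensor_mem (i := i) _ (fun a ha => Λ.extInr_mem (by simpa using ha))
        (Submodule.sub_mem _ ?_ (dt_mem (φ.body_mem hf))))
    have := φ.soul_mem (M.Q_mem hf)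
    rwa [add_sub_cancel_right] at this

/-- A function on the space of super-curves (functor of points): a rule which assigns to every
family of super-curves over `L` a function on `L`. -/
abbrev CurveFun (M : NQAlg.{u}) : Type _ := ∀ Λ : TestAlg.{v}, SuperCurve M Λ → Λ.carrier

/-- The BRST differential on functions of super-curves:
`F(φ + τ (Qφ - Dφ)) = F(φ) + τ (δ_B F)(φ)`. -/
def deltaB {M : NQAlg.{u}} (F : CurveFun.{u, v} M) : CurveFun.{u, v} M :=
  fun Λ φ => Λ.extSoul (F Λ.ext φ.shift)

theorem evalAt_mem {G : GrAlg.{u}} {i : ℤ} {p : PathAlg G} (hp : p ∈ pathGr G i)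
    (t : unitInterval) : evalAt G t p ∈ G.gr i := by
  obtain ⟨x, rfl⟩ := hp
  induction x using TensorProduct.induction_on with
  | zero => simp
  | add x y hx hy =>
    rw [map_add, map_add]
    exact Submodule.add_mem _ hx hy
  | tmul g a => simpa [evalAt] using Submodule.smul_mem _ _ a.2

theorem SuperCurve.value_mem {M : NQAlg.{u}} {Λ : TestAlg.{v}} (φ : SuperCurve M Λ)
    (t : unitInterval) {i : ℤ} {f : M.carrier} (hf : f ∈ M.gr i) : φ.value t f ∈ Λ.gr i :=
  evalAt_mem (φ.body_mem hf) t

/-- A super-curve with fibre coordinates `ζ_α` of `E` over its final point and dual fibre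
coordinates `ζ^α` over its initial point. -/
structure FramedCurve (M : NQAlg.{u}) {ι : Type} [Fintype ι] (E : QRep M ι) (Λ : TestAlg.{v})
    extends SuperCurve M Λ where
  z : ι → Λ.carrier
  w : ι → Λ.carrier
  z_mem : ∀ α, z α ∈ Λ.gr (E.lev α)
  w_mem : ∀ α, w α ∈ Λ.gr (-E.lev α)

/-- The flow of `δ_B` on framed curves: `δ_B ζ_α = (-1)^β ζ_β T^β_α(1)` and
`δ_B ζ^α = - T^α_β(0) ζ^β`. -/
def FramedCurve.shift {M : NQAlg.{u}} {ι : Type} [Fintype ι] {E : QRep M ι} {Λ : TestAlg.{v}}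
    (p : FramedCurve M E Λ) : FramedCurve M E Λ.ext where
  toSuperCurve := p.toSuperCurve.shift
  z α := Λ.extInl (p.z α) +
    Λ.extInr (∑ β, (-1 : ℝ) ^ E.lev β • (p.z β * p.value 1 (E.T β α)))
  w α := Λ.extInl (p.w α) - Λ.extInr (∑ β, p.value 0 (E.T α β) * p.w β)
  z_mem α := by
    refine Submodule.add_mem _ (Λ.extInl_mem (p.z_mem α)) (Λ.extInr_mem
      (Submodule.sum_mem _ fun β _ => Submodule.smul_mem _ _ ?_))
    have := SetLike.mul_mem_graded (p.z_mem β) (p.value_mem 1 (E.T_mem β α))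
    convert this using 2
    ring
  w_mem α := by
    refine Submodule.sub_mem _ (Λ.extInl_mem (p.w_mem α)) (Λ.extInr_mem
      (Submodule.sum_mem _ fun β _ => ?_))
    have := SetLike.mul_mem_graded (p.value_mem 0 (E.T_mem α β)) (p.w_mem β)
    convert this using 2
    ring

/-- The BRST differential on functions of framed curves. -/
def deltaBHat {M : NQAlg.{u}} {ι : Type} [Fintype ι] {E : QRep M ι}
    (F : ∀ Λ : TestAlg.{v}, FramedCurve M E Λ → Λ.carrier) (Λ : TestAlg.{v})
    (p : FramedCurve M E Λ) : Λ.carrier :=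
  Λ.extSoul (F Λ.ext p.shift)

/-! ## Sums, integrals and derivatives in test algebras

The homogeneous pieces of a test algebra are finite dimensional, so convergence is convergence of
all coordinates, that is, of all linear functionals. -/

section

variable {V : Type*} [AddCommGroup V] [Module ℝ V]

/-- `x` is the sum of the series `u`. -/
def HasSeriesSum (u : ℕ → V) (x : V) : Prop :=
  ∀ l : V →ₗ[ℝ] ℝ, HasSum (fun q => l (u q)) (l x)

/-- `x` is the integral `∫_0^1 f(t) dt`. -/
def HasIntegral01 (f : unitInterval → V) (x : V) : Prop :=
  ∀ l : V →ₗ[ℝ] ℝ,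
    IntervalIntegrable (Set.IccExtend zero_le_one fun t => l (f t)) MeasureTheory.volume 0 1 ∧
    ∫ t in (0 : ℝ)..1, Set.IccExtend zero_le_one (fun t => l (f t)) t = l x

/-- `f` is differentiable at `s` with derivative `x`. -/
def HasDerivative (f : ℝ → V) (x : V) (s : ℝ) : Prop :=
  ∀ l : V →ₗ[ℝ] ℝ, HasDerivAt (fun r => l (f r)) (l x) s

open Classical in
/-- The sum of a series, `0` if it does not converge. -/
def seriesSum (u : ℕ → V) : V := if h : ∃ x, HasSeriesSum u x then h.choose else 0

open Classical in
/-- The integral `∫_0^1 f(t) dt`, `0` if it does not exist. -/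
def integral01 (f : unitInterval → V) : V := if h : ∃ x, HasIntegral01 f x then h.choose else 0

end

/-! ## The Wilson line -/

section wilson

variable {M : NQAlg.{u}} {ι : Type} [Fintype ι] [DecidableEq ι] {Λ : TestAlg.{v}}

/-- The iterated integral `∫_s^t dt₁ X(t₁) ∫_s^{t₁} dt₂ X(t₂) ⋯ ∫_s^{t_{q-1}} dt_q X(t_q)`, as a
function of `t`. -/
def iteratedIntegral {G : GrAlg.{v}} (X : Matrix ι ι (PathAlg G)) (s : unitInterval) :
    ℕ → Matrix ι ι (PathAlg G)
  | 0 => 1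
  | q + 1 => (X * iteratedIntegral X s q).map (primitive G s)

/-- The term of order `q` of the path-ordered exponential `P exp(- ∫_s^t dt dθ T)`. -/
def wilsonTerm (T : Matrix ι ι M.carrier) (φ : SuperCurve M Λ) (t s : unitInterval) (q : ℕ) :
    Matrix ι ι Λ.carrier :=
  (-1 : ℝ) ^ q • (iteratedIntegral (T.map φ.dtheta) s q).map (evalAt Λ.toGrAlg t)

/-- The Wilson line `U(t, s) = P exp(- ∫_s^t dt dθ T)` along the super-curve `φ`. -/
def wilson (T : Matrix ι ι M.carrier) (φ : SuperCurve M Λ) (t s : unitInterval) :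
    Matrix ι ι Λ.carrier :=
  Matrix.of fun α β => seriesSum fun q => wilsonTerm T φ t s q α β

/-- The integrand `U^α_δ(1,t) (-1)^δ (∂_θ ε^δ_γ)(t) U^γ_β(t,0)` of `V^α_β`. -/
def transgressionIntegrand (E : QRep M ι) (ε : Matrix ι ι M.carrier) (φ : SuperCurve M Λ)
    (t : unitInterval) : Matrix ι ι Λ.carrier :=
  wilson E.T φ 1 t *
    (Matrix.of fun δ γ => (-1 : ℝ) ^ E.lev δ • evalAt Λ.toGrAlg t (φ.dtheta (ε δ γ))) *
    wilson E.T φ t 0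

/-- `V^α_β = ∫_0^1 dt U^α_δ(1,t) (-1)^δ (∂_θ ε^δ_γ)(t) U^γ_β(t,0)`. -/
def transgression (E : QRep M ι) (ε : Matrix ι ι M.carrier) (φ : SuperCurve M Λ) :
    Matrix ι ι Λ.carrier :=
  Matrix.of fun α β => integral01 fun t => transgressionIntegrand E ε φ t α β

/-- The contraction `ζ_α A^α_β ζ^β`. -/
def sandwich (z : ι → Λ.carrier) (A : Matrix ι ι Λ.carrier) (w : ι → Λ.carrier) : Λ.carrier :=
  ∑ α, ∑ β, z α * A α β * w β

/-- The Wilson loop `∑ α, (-1)^α U^α_α(1,0)`. -/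
def wilsonLoop (lev : ι → ℤ) (T : Matrix ι ι M.carrier) (φ : SuperCurve M Λ) : Λ.carrier :=
  ∑ α, (-1 : ℝ) ^ lev α • wilson T φ 1 0 α α

end wilson

/-- The Wilson line `ζ_α U^α_β(1,0) ζ^β` of a framed curve in the trivialization obtained by the
infinitesimal change `s ε`: `T` becomes `T + s δ_ε T`, `ζ_α` becomes `ζ_α + s ζ_β ε^β_α(1)` and the
dual coordinate `ζ^α` becomes `ζ^α - s ε^α_β(0) ζ^β`. -/
def changedSection {M : NQAlg.{u}} {ι : Type} [Fintype ι] [DecidableEq ι] (E : QRep M ι)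
    (ε : Matrix ι ι M.carrier) {Λ : TestAlg.{v}} (p : FramedCurve M E Λ) (s : ℝ) : Λ.carrier :=
  sandwich (fun α => p.z α + s • ∑ β, p.z β * p.value 1 (ε β α))
    (wilson (E.T + s • E.deltaT ε) p.toSuperCurve 1 0)
    (fun α => p.w α - s • ∑ β, p.value 0 (ε α β) * p.w β)

/-- The super-curve is a family in the quotient space of solutions: the auxiliary fields (the
components of negative degree, which are the `f_θ` with `f` of degree `0`) vanish, and so do the
equations of motion (the degree `0` part of `Qφ - Dφ`). -/
def SuperCurve.OnShell {M : NQAlg.{u}} {Λ : TestAlg.{v}} (φ : SuperCurve M Λ) : Prop :=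
  ∀ f ∈ M.gr 0, φ.dtheta f = 0 ∧ φ.dtheta (M.Q f) = dt Λ.toGrAlg (φ.fld f)

/-- The super-curve is closed: its end points coincide. Every super-loop `T[1]S¹ × L → M` gives
such a curve. -/
def SuperCurve.IsLoop {M : NQAlg.{u}} {Λ : TestAlg.{v}} (φ : SuperCurve M Λ) : Prop :=
  ∀ f, φ.value 1 f = φ.value 0 f

end WilsonLine

end

open WilsonLine

noncomputable section

namespace WilsonLine

/-! ## Linear differential equations with smooth coefficients -/

namespace SmoothI

/-! Write X = ∂_θT along the curve and σ for the diagonal matrix of the signs (-1)^α. The entry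
X^α_β has degree |β| - |α|, and matrices graded in this way form an algebra (`levelAlg`), finite
dimensional because the homogeneous pieces of Λ are. The Wilson line is thus the transport of u' =
-Xu in a finite-dimensional space. Picard bounds of the form K^q |t - s|^q / q! give convergence,
the equation itself gives smoothness, and U(t,s) = U(t)W(s) with U' = -XU, W' = WX, WU = UW = 1
(`exists_isFundamental`). Uniqueness always enters algebraically: a path with zero derivative is
constant.

Three computations carry the formula for δ_ε U. Variation of constants: if X moves to X + sY, with
transport U_s, then WU_s is the transport for sWYU, hence a power series in s, and the first
variation of U(1) is -U(1)∫WYU (`hasDerivative_transport`). BRST differential of the transport: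
flatness of T gives ∂_θ(QT) = TX - σXσT, from which δ_B U(t) = σUσT(0) - T(t)U, so only the end
points contribute (`IsFundamental.shift`). BRST differential of V: in δ_B of Wσ(∂_θε)U the bulk
terms combine, up to σ, into ∂_t(WεU) - W∂_θ(δ_εT)U, and what remains contains T(0)
(`brst_transgression`). The total derivative integrates to the terms with ε(1) and ε(0), the next
term is the variation of U, and the rest are the terms with T at the end points. Contraction with
the fibre coordinates absorbs all end-point terms.

On solutions, superfields of degree at most 0 have no θ-component, and the same holds on the shifted
curve because the τ-part of that component is an equation of motion. If ε has degree 0, both V and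
δ_B V vanish. In general U is block triangular with respect to the level and ∂_θε strictly so; hence
the diagonal of V vanishes on the shifted curve, and the graded cyclicity of the supertrace cancels
the remaining terms for closed curves. -/

theorem extend_of_mem (g : SmoothI) {t : ℝ} (ht : t ∈ Set.Icc (0 : ℝ) 1) :
    g.extend t = g ⟨t, ht⟩ := Set.IccExtend_of_mem _ _ ht

theorem exists_bound (g : SmoothI) : ∃ C, ∀ t, |g.extend t| ≤ C := by
  obtain ⟨C, hC⟩ := (isCompact_Icc (a := (0 : ℝ)) (b := 1)).exists_bound_of_continuousOn
    g.continuous_extend.continuousOn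
  refine ⟨C, fun t => ?_⟩
  have := hC (Set.projIcc 0 1 zero_le_one t) (Set.projIcc 0 1 zero_le_one t).2
  rwa [extend_coe] at this

theorem integral_apply (s : unitInterval) (g : SmoothI) (t : unitInterval) :
    integral s g t = ∫ r in (s : ℝ)..t, g.extend r := rfl

theorem deriv_apply (g : SmoothI) (t : unitInterval) :
    deriv g t = derivWithin g.extend (Set.Icc 0 1) t := rfl

@[simp] theorem coe_add (f g : SmoothI) (t : unitInterval) : (f + g) t = f t + g t := rfl

@[simp] theorem coe_mul (f g : SmoothI) (t : unitInterval) : (f * g) t = f t * g t := rfl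

theorem coe_sum {κ : Type*} (S : Finset κ) (f : κ → SmoothI) (t : unitInterval) :
    (∑ k ∈ S, f k) t = ∑ k ∈ S, f k t := map_sum (eval t) f S

theorem integral_deriv (s : unitInterval) (g : SmoothI) (t : unitInterval) :
    integral s (deriv g) t = g t - g s := by
  have hsub : Set.uIcc (s : ℝ) t ⊆ Set.Icc 0 1 := Set.uIcc_subset_Icc s.2 t.2
  rw [integral_apply, ← extend_coe g t, ← extend_coe g s]
  refine intervalIntegral.integral_eq_sub_of_hasDeriv_right
    g.continuous_extend.continuousOn (fun x hx => ?_)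
    ((deriv g).continuous_extend.intervalIntegrable _ _)
  -- `derivWithin` is an ordinary derivative only in the interior; continuity at the end points
  -- suffices for the fundamental theorem of calculus.
  have hx' : x ∈ Set.Ioo (0 : ℝ) 1 :=
    ⟨(le_min s.2.1 t.2.1).trans_lt hx.1, hx.2.trans_le (max_le s.2.2 t.2.2)⟩
  have h2 : x ∈ Set.Icc (0 : ℝ) 1 := Set.Ioo_subset_Icc_self hx'
  have h3 := (g.differentiableWithinAt ⟨x, h2⟩).hasDerivWithinAt
  rw [extend_of_mem _ h2]
  exact (h3.hasDerivAt (Icc_mem_nhds hx'.1 hx'.2)).hasDerivWithinAt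

variable {κ : Type*} [Fintype κ]

/-- The terms of the Picard series for `u' = a u`, `u(s) = v`, as functions on the real line. -/
def picardReal (a : Matrix κ κ SmoothI) (s : ℝ) (v : κ → ℝ) : ℕ → κ → ℝ → ℝ
  | 0 => fun k _ => v k
  | q + 1 => fun k t => ∫ r in s..t, ∑ j, (a k j).extend r * picardReal a s v q j r

theorem continuous_picardReal (a : Matrix κ κ SmoothI) (s : ℝ) (v : κ → ℝ) (q : ℕ) (k : κ) :
    Continuous (picardReal a s v q k) := by
  induction q generalizing k with
  | zero => exact continuous_const
  | succ q ih =>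
    have hc : Continuous fun r => ∑ j, (a k j).extend r * picardReal a s v q j r :=
      continuous_finsetSum _ fun j _ => (a k j).continuous_extend.mul (ih j)
    exact intervalIntegral.continuous_primitive (fun _ _ => hc.intervalIntegrable _ _) _

theorem hasDerivAt_picardReal_succ (a : Matrix κ κ SmoothI) (s : ℝ) (v : κ → ℝ) (q : ℕ) (k : κ)
    (t : ℝ) : HasDerivAt (picardReal a s v (q + 1) k)
      (∑ j, (a k j).extend t * picardReal a s v q j t) t := by
  have hc : Continuous fun r => ∑ j, (a k j).extend r * picardReal a s v q j r :=
    continuous_finsetSum _ fun j _ =>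
      (a k j).continuous_extend.mul (continuous_picardReal a s v q j)
  exact intervalIntegral.integral_hasDerivAt_right (hc.intervalIntegrable _ _)
    (hc.stronglyMeasurableAtFilter _ _) hc.continuousAt

theorem sum_extend_mul_le (a : Matrix κ κ SmoothI) {K m : ℝ}
    (hK : ∀ k t, ∑ j, |(a k j).extend t| ≤ K) (hm : 0 ≤ m) (w : κ → ℝ) (hw : ∀ j, |w j| ≤ m)
    (k : κ) (t : ℝ) : |∑ j, (a k j).extend t * w j| ≤ K * m := calc
  _ ≤ ∑ j, |(a k j).extend t| * m := (Finset.abs_sum_le_sum_abs _ _).trans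
    (Finset.sum_le_sum fun j _ => by
      rw [abs_mul]; exact mul_le_mul_of_nonneg_left (hw j) (abs_nonneg _))
  _ ≤ K * m := by
    rw [← Finset.sum_mul]; exact mul_le_mul_of_nonneg_right (hK k t) hm

/-- Each integration turns |r - s|^q into |t - s|^(q+1)/(q+1), which builds up the factorial. K
bounds the row sums of the coefficients and m the initial value. -/
theorem abs_picardReal_le (a : Matrix κ κ SmoothI) (s : ℝ) (v : κ → ℝ) {K m : ℝ} (hK0 : 0 ≤ K)
    (hK : ∀ k t, ∑ j, |(a k j).extend t| ≤ K) (hm : 0 ≤ m) (hv : ∀ j, |v j| ≤ m) (q : ℕ)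
    (k : κ) (t : ℝ) :
    |picardReal a s v q k t| ≤ m * (K ^ q * |t - s| ^ q / q.factorial) := by
  induction q generalizing k t with
  | zero => simpa [picardReal] using hv k
  | succ q ih =>
    rw [picardReal, ← Real.norm_eq_abs]
    have hb : ∀ r, ‖∑ j, (a k j).extend r * picardReal a s v q j r‖ ≤
        K * m * K ^ q / q.factorial * |r - s| ^ q := fun r => by
      have := sum_extend_mul_le a hK (m := m * (K ^ q * |r - s| ^ q / q.factorial))
        (by positivity) (fun j => picardReal a s v q j r) (fun j => ih j r) k r
      refine this.trans (le_of_eq ?_)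
      ring
    refine (intervalIntegral.norm_integral_le_abs_of_norm_le
      (Filter.Eventually.of_forall hb) ?_).trans (le_of_eq ?_)
    · exact Continuous.intervalIntegrable (by fun_prop) _ _
    · have h0 : 0 ≤ K * m * K ^ q / q.factorial := by positivity
      rw [intervalIntegral.integral_const_mul, abs_mul, abs_of_nonneg h0,
        intervalIntegral.abs_intervalIntegral_eq, integral_pow_abs_sub_uIoc,
        abs_of_nonneg (by positivity), Nat.factorial_succ]
      have : (q.factorial : ℝ) ≠ 0 := by positivity
      have : (q : ℝ) + 1 ≠ 0 := by positivity
      push_cast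
      field_simp
      ring

theorem exists_sum_bound (a : Matrix κ κ SmoothI) :
    ∃ K, 0 ≤ K ∧ ∀ k t, ∑ j, |(a k j).extend t| ≤ K := by
  choose C hC using fun k j => (a k j).exists_bound
  have hC0 : ∀ k j, 0 ≤ C k j := fun k j => (abs_nonneg _).trans (hC k j 0)
  refine ⟨∑ k, ∑ j, C k j, Finset.sum_nonneg fun k _ => Finset.sum_nonneg fun j _ => hC0 k j,
    fun k t => (Finset.sum_le_sum fun j _ => hC k j t).trans ?_⟩
  exact Finset.single_le_sum (f := fun k => ∑ j, C k j)
    (fun k _ => Finset.sum_nonneg fun j _ => hC0 k j) (Finset.mem_univ k)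

theorem summable_picardReal (a : Matrix κ κ SmoothI) (s : ℝ) (v : κ → ℝ) (k : κ) (t : ℝ) :
    Summable fun q => picardReal a s v q k t := by
  obtain ⟨K, hK0, hK⟩ := exists_sum_bound a
  refine Summable.of_norm_bounded (((Real.summable_pow_div_factorial (K * |t - s|))).mul_left
    (∑ j, |v j|)) fun q => ?_
  have := abs_picardReal_le a s v hK0 hK (Finset.sum_nonneg fun j _ => abs_nonneg (v j))
    (fun j => Finset.single_le_sum (f := fun j => |v j|) (fun _ _ => abs_nonneg _)
      (Finset.mem_univ j)) q k t
  rwa [← mul_pow] at this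

/-- Differentiating the term of order q + 1 gives a times the term of order q, so the series of
derivatives is a times the original series. -/
theorem hasDerivAt_tsum_picardReal (a : Matrix κ κ SmoothI) (s : ℝ) (v : κ → ℝ) (k : κ) (t : ℝ) :
    HasDerivAt (fun t => ∑' q, picardReal a s v q k t)
      (∑ j, (a k j).extend t * ∑' q, picardReal a s v q j t) t := by
  obtain ⟨K, hK0, hK⟩ := exists_sum_bound a
  set m := ∑ j, |v j|
  have hm : 0 ≤ m := Finset.sum_nonneg fun j _ => abs_nonneg (v j)
  have hv : ∀ j, |v j| ≤ m := fun j => Finset.single_le_sum (f := fun j => |v j|)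
    (fun _ _ => abs_nonneg _) (Finset.mem_univ j)
  -- Termwise differentiation needs a uniform summable bound on a connected open set containing both
  -- s and t; the ball of radius R around s serves.
  set R := |t - s| + 1
  have hR : 0 < R := by positivity
  let g' : ℕ → ℝ → ℝ := fun q t => match q with
    | 0 => 0
    | q + 1 => ∑ j, (a k j).extend t * picardReal a s v q j t
  let b : ℕ → ℝ := fun q => match q with
    | 0 => 0
    | q + 1 => K * (m * ((K * R) ^ q / q.factorial))
  have hb : Summable b := (summable_nat_add_iff 1).1
    (((Real.summable_pow_div_factorial (K * R)).mul_left m).mul_left K)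
  have key := hasDerivAt_tsum_of_isPreconnected (g := fun q => picardReal a s v q k) (g' := g')
    (t := Metric.ball s R) (y₀ := s) (y := t) hb Metric.isOpen_ball
    (convex_ball s R).isPreconnected (fun q y _ => ?_) (fun q y hy => ?_)
    (Metric.mem_ball_self hR) (summable_picardReal a s v k s)
    (by rw [Metric.mem_ball, Real.dist_eq]; exact lt_add_one _)
  · have hsum : ∀ j, HasSum (fun q => (a k j).extend t * picardReal a s v q j t)
        ((a k j).extend t * ∑' q, picardReal a s v q j t) := fun j =>
      (summable_picardReal a s v j t).hasSum.mul_left _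
    have h2 := hasSum_sum fun j (_ : j ∈ Finset.univ) => hsum j
    have h3 : HasSum (fun q => g' q t)
        (∑ j, (a k j).extend t * ∑' q, picardReal a s v q j t) := by
      rw [← hasSum_nat_add_iff' 1]
      simpa [g'] using h2
    rwa [h3.tsum_eq] at key
  · cases q with
    | zero => exact hasDerivAt_const _ _
    | succ q => exact hasDerivAt_picardReal_succ a s v q k y
  · cases q with
    | zero => simp [g', b]
    | succ q =>
      refine sum_extend_mul_le a hK (by positivity) _ (fun j => ?_) k y
      refine (abs_picardReal_le a s v hK0 hK hm hv q j y).trans ?_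
      rw [← mul_pow]
      rw [Metric.mem_ball, Real.dist_eq] at hy
      gcongr

/-- The terms of the Picard series for `u' = a u`, `u(s) = v`. -/
def picard (a : Matrix κ κ SmoothI) (s : unitInterval) (v : κ → ℝ) : ℕ → κ → SmoothI
  | 0 => fun k => algebraMap ℝ SmoothI (v k)
  | q + 1 => fun k => integral s (∑ j, a k j * picard a s v q j)

theorem picard_apply (a : Matrix κ κ SmoothI) (s : unitInterval) (v : κ → ℝ) (q : ℕ) (k : κ)
    (t : unitInterval) : picard a s v q k t = picardReal a s v q k t := by
  induction q generalizing k t with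
  | zero => rfl
  | succ q ih =>
    rw [picard, integral_apply, picardReal]
    refine intervalIntegral.integral_congr fun r hr => ?_
    have hr' : r ∈ Set.Icc (0 : ℝ) 1 := Set.uIcc_subset_Icc s.2 t.2 hr
    simp only [extend_of_mem _ hr', coe_sum, coe_mul, ih]

/-- The Picard series of a linear differential equation converges to a smooth solution. -/
theorem exists_solution (a : Matrix κ κ SmoothI) (s : unitInterval) (v : κ → ℝ) :
    ∃ u : κ → SmoothI, (∀ k, deriv (u k) = ∑ j, a k j * u j) ∧
      ∀ k t, HasSum (fun q => picard a s v q k t) (u k t) := by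
  -- The coefficients are extended by constants outside [0, 1], so w solves the equation on the
  -- whole line and has two-sided derivatives at the end points as well.
  let w : κ → ℝ → ℝ := fun k t => ∑' q, picardReal a s v q k t
  have hw : ∀ k t, HasDerivAt (w k) (∑ j, (a k j).extend t * w j t) t :=
    hasDerivAt_tsum_picardReal a s v
  have hU := uniqueDiffOn_Icc (zero_lt_one (α := ℝ))
  have hd : ∀ k, ∀ t ∈ Set.Icc (0 : ℝ) 1, derivWithin (w k) (Set.Icc 0 1) t =
      ∑ j, (a k j).extend t * w j t := fun k t ht =>
    (hw k t).hasDerivWithinAt.derivWithin (hU t ht)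
  -- Bootstrap: if w is n times continuously differentiable, so is w' = a w.
  have hn : ∀ n : ℕ, ∀ k, ContDiffOn ℝ n (w k) (Set.Icc 0 1) := by
    intro n
    induction n with
    | zero => exact fun k => contDiffOn_zero.2 fun t _ => (hw k t).continuousAt.continuousWithinAt
    | succ n ih =>
      intro k
      rw [Nat.cast_succ, contDiffOn_succ_iff_derivWithin hU]
      refine ⟨fun t _ => (hw k t).differentiableAt.differentiableWithinAt, by simp, ?_⟩
      refine ContDiffOn.congr ?_ (hd k)
      exact ContDiffOn.sum fun j _ => ((a k j).contDiffOn.of_le (by exact_mod_cast le_top)).mul (ih j)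
  refine ⟨fun k => ofContDiffOn (w k) (contDiffOn_infty.2 fun n => hn n k), fun k => ?_,
    fun k t => ?_⟩
  · ext t
    have h1 : Set.EqOn (ofContDiffOn (w k) (contDiffOn_infty.2 fun n => hn n k)).extend (w k)
        (Set.Icc 0 1) := fun t ht => extend_of_mem _ ht
    rw [deriv_apply, derivWithin_congr h1 (h1 t.2), hd k t t.2, coe_sum]
    simp
  · simp only [picard_apply]
    exact (summable_picardReal a s v k t).hasSum

end SmoothI

/-! ## Calculus of vector valued paths -/

section vectorPath

variable {F : Type*} [AddCommGroup F] [Module ℝ F]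

/-- Evaluation of a vector valued path at the time `t`. -/
def pathEval (F : Type*) [AddCommGroup F] [Module ℝ F] (t : unitInterval) :
    SmoothI ⊗[ℝ] F →ₗ[ℝ] F :=
  (TensorProduct.lid ℝ F).toLinearMap ∘ₗ LinearMap.rTensor F (SmoothI.eval t).toLinearMap

/-- The derivative of a vector valued path. -/
def pathDeriv (F : Type*) [AddCommGroup F] [Module ℝ F] : SmoothI ⊗[ℝ] F →ₗ[ℝ] SmoothI ⊗[ℝ] F :=
  LinearMap.rTensor F SmoothI.deriv

/-- The primitive of a vector valued path which vanishes at `s`. -/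
def pathPrim (F : Type*) [AddCommGroup F] [Module ℝ F] (s : unitInterval) :
    SmoothI ⊗[ℝ] F →ₗ[ℝ] SmoothI ⊗[ℝ] F :=
  LinearMap.rTensor F (SmoothI.integral s)

@[simp] theorem pathEval_tmul (t : unitInterval) (g : SmoothI) (x : F) :
    pathEval F t (g ⊗ₜ x) = g t • x := by simp [pathEval]

@[simp] theorem pathDeriv_tmul (g : SmoothI) (x : F) :
    pathDeriv F (g ⊗ₜ x) = SmoothI.deriv g ⊗ₜ x := by simp [pathDeriv]

@[simp] theorem pathPrim_tmul (s : unitInterval) (g : SmoothI) (x : F) :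
    pathPrim F s (g ⊗ₜ x) = SmoothI.integral s g ⊗ₜ x := by simp [pathPrim]

theorem SmoothI.integral_deriv_eq (s : unitInterval) (g : SmoothI) :
    SmoothI.integral s (SmoothI.deriv g) = g - g s • (1 : SmoothI) := by
  ext t
  rw [SmoothI.integral_deriv]
  change _ = g t - g s * 1
  rw [mul_one]

/-- The fundamental theorem of calculus for vector valued paths, reduced to elementary tensors. It
is the source of every uniqueness argument below: zero derivative forces the path to be its value at
s. -/
theorem pathPrim_pathDeriv (s : unitInterval) (p : SmoothI ⊗[ℝ] F) :
    pathPrim F s (pathDeriv F p) = p - (1 : SmoothI) ⊗ₜ pathEval F s p := by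
  induction p using TensorProduct.induction_on with
  | zero => simp
  | add x y hx hy => simp only [map_add, hx, hy, TensorProduct.tmul_add]; abel
  | tmul g x =>
    simp [SmoothI.integral_deriv_eq, TensorProduct.sub_tmul, TensorProduct.smul_tmul]

theorem pathEval_one_tmul (t : unitInterval) (x : F) :
    pathEval F t ((1 : SmoothI) ⊗ₜ x) = x := by
  rw [pathEval_tmul]
  exact one_smul ℝ x

theorem pathEval_lTensor {F' : Type*} [AddCommGroup F'] [Module ℝ F'] (h : F →ₗ[ℝ] F')
    (t : unitInterval) (p : SmoothI ⊗[ℝ] F) :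
    pathEval F' t (LinearMap.lTensor SmoothI h p) = h (pathEval F t p) := by
  induction p using TensorProduct.induction_on with
  | zero => simp
  | add x y hx hy => simp only [map_add, hx, hy]
  | tmul g x => simp

theorem pathDeriv_lTensor {F' : Type*} [AddCommGroup F'] [Module ℝ F'] (h : F →ₗ[ℝ] F')
    (p : SmoothI ⊗[ℝ] F) :
    pathDeriv F' (LinearMap.lTensor SmoothI h p) = LinearMap.lTensor SmoothI h (pathDeriv F p) := by
  induction p using TensorProduct.induction_on with
  | zero => simp
  | add x y hx hy => simp only [map_add, hx, hy]
  | tmul g x => simp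

theorem pathPrim_lTensor {F' : Type*} [AddCommGroup F'] [Module ℝ F'] (h : F →ₗ[ℝ] F')
    (s : unitInterval) (p : SmoothI ⊗[ℝ] F) :
    pathPrim F' s (LinearMap.lTensor SmoothI h p) =
      LinearMap.lTensor SmoothI h (pathPrim F s p) := by
  induction p using TensorProduct.induction_on with
  | zero => simp
  | add x y hx hy => simp only [map_add, hx, hy]
  | tmul g x => simp

/-- The values of a functional along a path form a smooth function. -/
theorem exists_smoothI_eq (l : F →ₗ[ℝ] ℝ) (p : SmoothI ⊗[ℝ] F) :
    ∃ g : SmoothI, (∀ t, g t = l (pathEval F t p)) ∧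
      ∀ s t, SmoothI.integral s g t = l (pathEval F t (pathPrim F s p)) := by
  induction p using TensorProduct.induction_on with
  | zero => exact ⟨0, fun t => by simp; rfl, fun s t => by simp; rfl⟩
  | add x y hx hy =>
    obtain ⟨g, hg, hg'⟩ := hx
    obtain ⟨h, hh, hh'⟩ := hy
    exact ⟨g + h, fun t => by simp [hg, hh], fun s t => by simp [hg', hh']⟩
  | tmul g x =>
    refine ⟨l x • g, fun t => ?_, fun s t => ?_⟩
    · simp only [pathEval_tmul, map_smul, smul_eq_mul]
      exact mul_comm _ _
    · simp only [pathPrim_tmul, pathEval_tmul, map_smul, smul_eq_mul]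
      exact mul_comm _ _

theorem hasIntegral01_pathEval (p : SmoothI ⊗[ℝ] F) :
    HasIntegral01 (fun t => pathEval F t p) (pathEval F 1 (pathPrim F 0 p)) := by
  intro l
  obtain ⟨g, hg, hg'⟩ := exists_smoothI_eq l p
  have h : (Set.IccExtend zero_le_one fun t : unitInterval => l (pathEval F t p)) = g.extend := by
    unfold SmoothI.extend
    congr 1
    exact funext fun t => (hg t).symm
  rw [h, ← hg']
  exact ⟨g.continuous_extend.intervalIntegrable _ _, rfl⟩

variable [FiniteDimensional ℝ F]

/-- The Picard series of a linear differential equation in a finite-dimensional space converges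
to a smooth solution. -/
theorem exists_path_solution (A : SmoothI ⊗[ℝ] F →ₗ[SmoothI] SmoothI ⊗[ℝ] F) (s : unitInterval)
    (f : F) (I : ℕ → SmoothI ⊗[ℝ] F) (h0 : I 0 = 1 ⊗ₜ f)
    (hI : ∀ q, I (q + 1) = pathPrim F s (A (I q))) :
    ∃ p, pathDeriv F p = A p ∧ pathEval F s p = f ∧
      ∀ (l : F →ₗ[ℝ] ℝ) (t : unitInterval),
        HasSum (fun q => l (pathEval F t (I q))) (l (pathEval F t p)) := by
  let b := Module.finBasis ℝ F
  let c := Algebra.TensorProduct.basis SmoothI b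
  have hc : ∀ k, c k = (1 : SmoothI) ⊗ₜ b k := fun k => Algebra.TensorProduct.basis_apply _ _
  let a : Matrix _ _ SmoothI := Matrix.of fun k j => c.repr (A (c j)) k
  -- Linearity over `SmoothI` makes A a matrix of smooth functions in the basis of constant vectors,
  -- which reduces the equation to the scalar system.
  have hA : ∀ g : _ → SmoothI, A (∑ j, g j ⊗ₜ b j) = ∑ k, (∑ j, a k j * g j) ⊗ₜ b k := fun g => by
    have h1 : ∀ (g : SmoothI) k, g ⊗ₜ[ℝ] b k = g • c k := fun g k => by
      rw [hc, TensorProduct.smul_tmul', smul_eq_mul, mul_one]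
    simp only [h1, map_sum, map_smul]
    have h2 : ∀ j, A (c j) = ∑ k, a k j • c k := fun j => (c.sum_repr _).symm
    simp only [h2, Finset.smul_sum, Finset.sum_smul, smul_smul]
    rw [Finset.sum_comm]
    exact Finset.sum_congr rfl fun _ _ => Finset.sum_congr rfl fun _ _ => by rw [mul_comm]
  obtain ⟨u, hu, hs⟩ := SmoothI.exists_solution a s (b.repr f)
  have hIq : ∀ q, I q = ∑ k, SmoothI.picard a s (b.repr f) q k ⊗ₜ b k := by
    intro q
    induction q with
    | zero =>
      rw [h0]
      conv_lhs => rw [← b.sum_repr f]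
      rw [TensorProduct.tmul_sum]
      refine Finset.sum_congr rfl fun k _ => ?_
      simp only [SmoothI.picard, Algebra.algebraMap_eq_smul_one, TensorProduct.smul_tmul]
    | succ q ih =>
      rw [hI, ih, hA, map_sum]
      simp only [pathPrim_tmul, SmoothI.picard]
  have hev : ∀ (l : F →ₗ[ℝ] ℝ) (t : unitInterval) (g : _ → SmoothI),
      l (pathEval F t (∑ k, g k ⊗ₜ b k)) = ∑ k, g k t * l (b k) := fun l t g => by
    simp [map_sum]
  refine ⟨∑ k, u k ⊗ₜ b k, ?_, ?_, fun l t => ?_⟩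
  · rw [hA, map_sum]
    simp only [pathDeriv_tmul, hu]
  · rw [map_sum]
    conv_rhs => rw [← b.sum_repr f]
    refine Finset.sum_congr rfl fun k _ => ?_
    rw [pathEval_tmul]
    congr 1
    refine (hs k s).unique ?_
    -- At t = s all terms of order at least one are integrals over a degenerate interval, so only
    -- the initial value survives.
    refine hasSum_single (f := fun q => SmoothI.picard a s (b.repr f) q k s) 0 ?_
    intro q hq
    obtain ⟨q, rfl⟩ := Nat.exists_eq_succ_of_ne_zero hq
    simp only [SmoothI.picard, SmoothI.integral_apply, intervalIntegral.integral_same]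
  · simp only [hIq, hev]
    exact hasSum_sum fun k _ => (hs k t).mul_right _

end vectorPath

/-! ## Series, integrals and derivatives tested by functionals -/

section weak

variable {V : Type*} [AddCommGroup V] [Module ℝ V]

/-- Functionals separate the points of a real vector space. Weak sums and integrals are therefore
unique, and the values chosen in `seriesSum` and `integral01` agree with any witness. -/
theorem eq_of_forall_functional {x y : V} (h : ∀ l : V →ₗ[ℝ] ℝ, l x = l y) : x = y := by
  rw [← sub_eq_zero, ← Module.forall_dual_apply_eq_zero_iff ℝ]
  intro l
  rw [map_sub, h l, sub_self]

theorem HasSeriesSum.seriesSum_eq {u : ℕ → V} {x : V} (h : HasSeriesSum u x) :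
    seriesSum u = x := by
  have he : ∃ x, HasSeriesSum u x := ⟨x, h⟩
  rw [seriesSum, dif_pos he]
  exact eq_of_forall_functional fun l => (he.choose_spec l).unique (h l)

theorem HasIntegral01.integral01_eq {f : unitInterval → V} {x : V} (h : HasIntegral01 f x) :
    integral01 f = x := by
  have he : ∃ x, HasIntegral01 f x := ⟨x, h⟩
  rw [integral01, dif_pos he]
  exact eq_of_forall_functional fun l => (he.choose_spec l).2.symm.trans (h l).2

/-- Convergence at s = 1 is absolute for real series, so for |s| ≤ 1 the tail from order two on is
at most a constant times s². -/
theorem hasDerivAt_zero_of_hasSum_pow {c : ℕ → ℝ} {f : ℝ → ℝ}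
    (h : ∀ s, HasSum (fun q => s ^ q * c q) (f s)) : HasDerivAt f (c 1) 0 := by
  have h0 : f 0 = c 0 := by
    refine (h 0).unique ?_
    convert hasSum_single (f := fun q => (0 : ℝ) ^ q * c q) 0 ?_ using 1
    · simp
    · intro q hq; simp [hq]
  have hs : Summable fun q => |c (q + 2)| :=
    by
    have h1 : Summable fun q => |c q| := by simpa using (h 1).summable.abs
    exact h1.comp_injective (add_left_injective 2)
  have hb : ∀ s : ℝ, |s| ≤ 1 → |f s - f 0 - s * c 1| ≤ (∑' q, |c (q + 2)|) * |s| ^ 2 := by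
    intro s hs1
    have h2 := (hasSum_nat_add_iff' 2).2 (h s)
    have e : f s - f 0 - s * c 1 = f s - ∑ i ∈ Finset.range 2, s ^ i * c i := by
      rw [h0]; simp [Finset.sum_range_succ]; ring
    have h3 : ∀ q, ‖s ^ (q + 2) * c (q + 2)‖ ≤ |c (q + 2)| * |s| ^ 2 := fun q => by
      rw [Real.norm_eq_abs, abs_mul, mul_comm, pow_add, abs_mul, abs_pow, abs_pow]
      refine mul_le_mul_of_nonneg_left ?_ (abs_nonneg _)
      exact mul_le_of_le_one_left (by positivity) (pow_le_one₀ (abs_nonneg _) hs1)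
    have h4 := h2.norm_le_of_bounded (hs.hasSum.mul_right (|s| ^ 2)) h3
    rwa [Real.norm_eq_abs, ← e] at h4
  rw [hasDerivAt_iff_isLittleO_nhds_zero]
  refine Asymptotics.IsBigO.trans_isLittleO (g := fun s : ℝ => s ^ 2) ?_ ?_
  · refine Asymptotics.IsBigO.of_bound (∑' q, |c (q + 2)|) ?_
    filter_upwards [Metric.closedBall_mem_nhds (0 : ℝ) one_pos] with s hs
    have := hb s (by simpa using hs)
    simpa using this
  · simpa using Asymptotics.isLittleO_pow_pow (𝕜 := ℝ) (m := 1) (n := 2) (by norm_num)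

theorem HasDerivative.add {f g : ℝ → V} {x y : V} {s : ℝ} (hf : HasDerivative f x s)
    (hg : HasDerivative g y s) : HasDerivative (fun r => f r + g r) (x + y) s := fun l => by
  simpa only [map_add] using (hf l).fun_add (hg l)

theorem HasDerivative.sum {κ : Type*} {S : Finset κ} {f : κ → ℝ → V} {x : κ → V} {s : ℝ}
    (hf : ∀ k ∈ S, HasDerivative (f k) (x k) s) :
    HasDerivative (fun r => ∑ k ∈ S, f k r) (∑ k ∈ S, x k) s := fun l => by
  simpa only [map_sum] using HasDerivAt.fun_sum fun k hk => hf k hk l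

theorem HasDerivative.map {W : Type*} [AddCommGroup W] [Module ℝ W] {f : ℝ → V} {x : V} {s : ℝ}
    (hf : HasDerivative f x s) (h : V →ₗ[ℝ] W) : HasDerivative (fun r => h (f r)) (h x) s :=
  fun l => hf (l ∘ₗ h)

theorem HasDerivative.smul_fun {f : ℝ → V} {x : V} {s : ℝ} {a : ℝ → ℝ} {a' : ℝ}
    (ha : HasDerivAt a a' s) (hf : HasDerivative f x s) :
    HasDerivative (fun r => a r • f r) (a' • f s + a s • x) s := fun l => by
  simpa only [map_add, map_smul, smul_eq_mul] using ha.fun_mul (hf l)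

end weak

/-! ## Fundamental solutions in a finite-dimensional algebra -/

section algebra

variable {B : Type*} [Ring B] [Algebra ℝ B]

theorem pathEval_mul (t : unitInterval) (p q : SmoothI ⊗[ℝ] B) :
    pathEval B t (p * q) = pathEval B t p * pathEval B t q := by
  induction p using TensorProduct.induction_on with
  | zero => simp
  | add x y hx hy => simp only [add_mul, map_add, hx, hy]
  | tmul f a =>
    induction q using TensorProduct.induction_on with
    | zero => simp
    | add x y hx hy => simp only [mul_add, map_add, hx, hy]
    | tmul g b => simp [smul_smul, mul_comm]

theorem pathDeriv_mul (p q : SmoothI ⊗[ℝ] B) :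
    pathDeriv B (p * q) = pathDeriv B p * q + p * pathDeriv B q := by
  induction p using TensorProduct.induction_on with
  | zero => simp
  | add x y hx hy =>
    simp only [add_mul, map_add, hx, hy]
    abel
  | tmul f a =>
    induction q using TensorProduct.induction_on with
    | zero => simp
    | add x y hx hy =>
      simp only [mul_add, map_add, hx, hy]
      abel
    | tmul g b => simp [SmoothI.deriv_mul, TensorProduct.add_tmul]

theorem eq_tmul_of_pathDeriv_eq_zero {p : SmoothI ⊗[ℝ] B} (hp : pathDeriv B p = 0)
    (s : unitInterval) : p = 1 ⊗ₜ pathEval B s p := by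
  have := pathPrim_pathDeriv s p
  rwa [hp, map_zero, eq_comm, sub_eq_zero] at this

variable [FiniteDimensional ℝ B]

/-- Paths in B form a finitely generated module over the commutative ring `SmoothI`, where a
surjective endomorphism is injective; this applies to left multiplication by g. It is needed because
the differential equations make only the product g w visibly constant. -/
theorem path_mul_eq_one_symm {g w : SmoothI ⊗[ℝ] B} (h : g * w = 1) : w * g = 1 := by
  have hs : Function.Surjective (LinearMap.mulLeft SmoothI g) := fun y =>
    ⟨w * y, by rw [LinearMap.mulLeft_apply, ← mul_assoc, h, one_mul]⟩
  have hi := OrzechProperty.injective_of_surjective_endomorphism _ hs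
  refine hi ?_
  simp only [LinearMap.mulLeft_apply, ← mul_assoc, h, one_mul, mul_one]

/-- The transport equation `u' = - x u` has an invertible fundamental solution, which is the
sum of the series of iterated integrals. -/
theorem exists_path_fundamental (x : SmoothI ⊗[ℝ] B) :
    ∃ w g : SmoothI ⊗[ℝ] B, pathDeriv B w = -(x * w) ∧ pathDeriv B g = g * x ∧
      pathEval B 0 w = 1 ∧ pathEval B 0 g = 1 ∧ g * w = 1 ∧ w * g = 1 ∧
      ∀ (s : unitInterval) (I : ℕ → SmoothI ⊗[ℝ] B), I 0 = 1 →
        (∀ q, I (q + 1) = pathPrim B s (x * I q)) → ∀ (l : B →ₗ[ℝ] ℝ) (t : unitInterval),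
          HasSum (fun q => (-1 : ℝ) ^ q * l (pathEval B t (I q)))
            (l (pathEval B t w * pathEval B s g)) := by
  have hone : (1 : SmoothI ⊗[ℝ] B) = 1 ⊗ₜ 1 := rfl
  have key : ∀ (s : unitInterval), ∃ w, pathDeriv B w = -(x * w) ∧ pathEval B s w = 1 ∧
      ∀ I : ℕ → SmoothI ⊗[ℝ] B, I 0 = 1 → (∀ q, I (q + 1) = pathPrim B s (x * I q)) →
        ∀ (l : B →ₗ[ℝ] ℝ) (t : unitInterval),
          HasSum (fun q => (-1 : ℝ) ^ q * l (pathEval B t (I q))) (l (pathEval B t w)) := by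
    intro s
    let I : ℕ → SmoothI ⊗[ℝ] B := fun q => Nat.rec 1 (fun _ y => pathPrim B s (x * y)) q
    have huniq : ∀ I' : ℕ → SmoothI ⊗[ℝ] B, I' 0 = 1 →
        (∀ q, I' (q + 1) = pathPrim B s (x * I' q)) → I' = I := fun I' h0 h1 => by
      funext q
      induction q with
      | zero => exact h0
      | succ q ih => rw [h1, ih]
    -- The sign (-1)^q of the path-ordered exponential is absorbed by the coefficient -x.
    obtain ⟨w, h1, h2, h3⟩ := exists_path_solution (LinearMap.mulLeft SmoothI (-x)) s (1 : B)
      (fun q => (-1 : ℝ) ^ q • I q) (by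
        change (-1 : ℝ) ^ 0 • (1 : SmoothI ⊗[ℝ] B) = _
        rw [pow_zero, one_smul, hone]) (fun q => by
        change (-1 : ℝ) ^ (q + 1) • pathPrim B s (x * I q) = _
        rw [LinearMap.mulLeft_apply, neg_mul, mul_smul_comm, map_neg, map_smul, pow_succ, mul_neg,
          mul_one, neg_smul])
    refine ⟨w, by simpa using h1, h2, fun I' h0' h1' l t => ?_⟩
    rw [huniq I' h0' h1']
    simpa only [map_smul, smul_eq_mul] using h3 l t
  obtain ⟨w, hw, hw0, -⟩ := key 0
  -- The adjoint equation g' = g x makes g y constant for every solution y of y' = -x y; thus g is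
  -- the inverse transport.
  obtain ⟨g, hg, hg0, -⟩ := exists_path_solution (LinearMap.mulRight SmoothI x) 0 (1 : B)
    (fun q => Nat.rec 1 (fun _ y => pathPrim B 0 (y * x)) q) hone (fun q => rfl)
  rw [LinearMap.mulRight_apply] at hg
  have hD : ∀ y, pathDeriv B y = -(x * y) → pathDeriv B (g * y) = 0 := fun y hy => by
    rw [pathDeriv_mul, hg, hy, mul_neg, mul_assoc, add_neg_cancel]
  have hgw : g * w = 1 := by
    rw [eq_tmul_of_pathDeriv_eq_zero (hD w hw) 0, pathEval_mul, hg0, hw0, mul_one, hone]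
  have hwg := path_mul_eq_one_symm hgw
  refine ⟨w, g, hw, hg, hw0, hg0, hgw, hwg, fun s I h0 h1 l t => ?_⟩
  obtain ⟨y, hy, hys, hsum⟩ := key s
  -- For the solution y with y(s) = 1, the constant g y equals its value g(s) at s; multiplying by w
  -- from the left recovers y.
  have : y = w * 1 ⊗ₜ pathEval B s g := by
    have h2 := eq_tmul_of_pathDeriv_eq_zero (hD y hy) s
    rw [pathEval_mul, hys, mul_one] at h2
    rw [← h2, ← mul_assoc, hwg, one_mul]
  have h3 : pathEval B t w * pathEval B s g = pathEval B t y := by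
    rw [this, pathEval_mul, pathEval_one_tmul]
  rw [h3]
  exact hsum I h0 h1 l t

end algebra

/-! ## Matrices of paths -/

section graded

variable {G : GrAlg.{v}}

theorem evalAt_eq_pathEval (t : unitInterval) (p : PathAlg G) :
    evalAt G t p = pathEval G.carrier t p := by
  induction p using TensorProduct.induction_on with
  | zero => simp
  | add x y hx hy => simp only [map_add, hx, hy]
  | tmul g a => simp [evalAt]

/-- Constant paths. -/
def constPath (G : GrAlg.{v}) : G.carrier →ₐ[ℝ] PathAlg G :=
  Algebra.TensorProduct.includeRight

theorem constPath_apply (a : G.carrier) : constPath G a = 1 ⊗ₜ a := rfl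

@[simp] theorem evalAt_constPath (t : unitInterval) (a : G.carrier) :
    evalAt G t (constPath G a) = a := by
  rw [evalAt_eq_pathEval, constPath_apply, pathEval_one_tmul]

@[simp] theorem dt_constPath (a : G.carrier) : dt G (constPath G a) = 0 := by
  have h : SmoothI.deriv 1 = 0 := by
    have := SmoothI.deriv_mul 1 1
    simpa using this
  change dt G (1 ⊗ₜ a) = 0
  rw [dt, LinearMap.rTensor_tmul, h, TensorProduct.zero_tmul]

theorem primitive_dt (s : unitInterval) (p : PathAlg G) :
    primitive G s (dt G p) = p - constPath G (evalAt G s p) := by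
  rw [evalAt_eq_pathEval]
  exact pathPrim_pathDeriv s p

theorem primitive_const_mul (s : unitInterval) (a : G.carrier) (p : PathAlg G) :
    primitive G s (constPath G a * p) = constPath G a * primitive G s p := by
  induction p using TensorProduct.induction_on with
  | zero => simp
  | add x y hx hy => simp only [mul_add, map_add, hx, hy]
  | tmul g b => simp [primitive, constPath_apply]

theorem primitive_mul_const (s : unitInterval) (a : G.carrier) (p : PathAlg G) :
    primitive G s (p * constPath G a) = primitive G s p * constPath G a := by
  induction p using TensorProduct.induction_on with
  | zero => simp
  | add x y hx hy => simp only [add_mul, map_add, hx, hy]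
  | tmul g b => simp [primitive, constPath_apply]

theorem pathGr_mul {i j : ℤ} {p q : PathAlg G} (hp : p ∈ pathGr G i) (hq : q ∈ pathGr G j) :
    p * q ∈ pathGr G (i + j) := by
  obtain ⟨x, rfl⟩ := hp
  obtain ⟨y, rfl⟩ := hq
  induction x using TensorProduct.induction_on with
  | zero => simp
  | add x x' hx hx' => rw [map_add, add_mul]; exact Submodule.add_mem _ hx hx'
  | tmul f a =>
    induction y using TensorProduct.induction_on with
    | zero => simp
    | add y y' hy hy' => rw [map_add, mul_add]; exact Submodule.add_mem _ hy hy'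
    | tmul g b =>
      exact ⟨(f * g) ⊗ₜ ⟨a * b, SetLike.mul_mem_graded a.2 b.2⟩, by simp⟩

theorem primitive_mem {i : ℤ} {p : PathAlg G} (hp : p ∈ pathGr G i) (s : unitInterval) :
    primitive G s p ∈ pathGr G i := by
  obtain ⟨x, rfl⟩ := hp
  induction x using TensorProduct.induction_on with
  | zero => simp
  | add x y hx hy => rw [map_add, map_add]; exact Submodule.add_mem _ hx hy
  | tmul g a => exact ⟨SmoothI.integral s g ⊗ₜ a, by simp [primitive]⟩

variable {ι : Type} [Fintype ι] [DecidableEq ι]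

/-- The matrices with entries `A^α_β` of degree `|β| - |α|` form an algebra. -/
def levelAlg (G : GrAlg.{v}) (lev : ι → ℤ) : Subalgebra ℝ (Matrix ι ι G.carrier) where
  carrier := {A | ∀ α β, A α β ∈ G.gr (lev β - lev α)}
  mul_mem' := by
    intro A A' hA hA' α β
    rw [Matrix.mul_apply]
    refine Submodule.sum_mem _ fun γ _ => ?_
    have := SetLike.mul_mem_graded (hA α γ) (hA' γ β)
    convert this using 2
    ring
  add_mem' := fun hA hA' α β => Submodule.add_mem _ (hA α β) (hA' α β)
  algebraMap_mem' := by
    intro r α β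
    rw [Matrix.algebraMap_matrix_apply]
    split_ifs with h
    · rw [h, sub_self, Algebra.algebraMap_eq_smul_one]
      exact Submodule.smul_mem _ _ (SetLike.one_mem_graded G.gr)
    · exact Submodule.zero_mem _

theorem finiteDimensional_levelAlg (hG : ∀ i, FiniteDimensional ℝ (G.gr i)) (lev : ι → ℤ) :
    FiniteDimensional ℝ (levelAlg G lev) := by
  let f : levelAlg G lev →ₗ[ℝ] (∀ α β, G.gr (lev β - lev α)) :=
    { toFun := fun A α β => ⟨A.1 α β, A.2 α β⟩
      map_add' := fun _ _ => rfl
      map_smul' := fun _ _ => rfl }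
  refine Module.Finite.of_injective f fun A A' h => Subtype.ext (Matrix.ext fun α β => ?_)
  exact congrArg Subtype.val (congrFun (congrFun h α) β)

/-- The entry `(α, β)` as a linear function. -/
def levelEntry (G : GrAlg.{v}) (lev : ι → ℤ) (α β : ι) : levelAlg G lev →ₗ[ℝ] G.carrier :=
  Matrix.entryLinearMap ℝ G.carrier α β ∘ₗ (levelAlg G lev).val.toLinearMap

@[simp] theorem levelEntry_apply (lev : ι → ℤ) (α β : ι) (A : levelAlg G lev) :
    levelEntry G lev α β A = A.1 α β := rfl

/-- A path of matrices as a matrix of paths. -/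
def levelPath (G : GrAlg.{v}) (lev : ι → ℤ) (p : SmoothI ⊗[ℝ] levelAlg G lev) :
    Matrix ι ι (PathAlg G) :=
  Matrix.of fun α β => LinearMap.lTensor SmoothI (levelEntry G lev α β) p

theorem levelPath_apply (lev : ι → ℤ) (p : SmoothI ⊗[ℝ] levelAlg G lev) (α β : ι) :
    levelPath G lev p α β = LinearMap.lTensor SmoothI (levelEntry G lev α β) p := rfl

theorem levelPath_mul (lev : ι → ℤ) (p q : SmoothI ⊗[ℝ] levelAlg G lev) :
    levelPath G lev (p * q) = levelPath G lev p * levelPath G lev q := by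
  ext α β
  simp only [Matrix.mul_apply, levelPath_apply]
  induction p using TensorProduct.induction_on with
  | zero => simp
  | add x y hx hy => simp only [add_mul, map_add, hx, hy, Finset.sum_add_distrib]
  | tmul f a =>
    induction q using TensorProduct.induction_on with
    | zero => simp
    | add x y hx hy => simp only [mul_add, map_add, hx, hy, Finset.sum_add_distrib]
    | tmul g b =>
      simp only [Algebra.TensorProduct.tmul_mul_tmul, LinearMap.lTensor_tmul, levelEntry_apply,
        ← TensorProduct.tmul_sum]
      congr 1

theorem levelPath_one (lev : ι → ℤ) : levelPath G lev 1 = 1 := by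
  ext α β
  change LinearMap.lTensor SmoothI _ (1 ⊗ₜ 1) = _
  rw [LinearMap.lTensor_tmul, levelEntry_apply, Matrix.one_apply]
  change (1 : SmoothI) ⊗ₜ[ℝ] (1 : Matrix ι ι G.carrier) α β = _
  rw [Matrix.one_apply]
  split_ifs
  · rfl
  · simp

theorem levelPath_neg (lev : ι → ℤ) (p : SmoothI ⊗[ℝ] levelAlg G lev) :
    levelPath G lev (-p) = -levelPath G lev p := by
  ext α β
  exact map_neg (LinearMap.lTensor SmoothI (levelEntry G lev α β)) p

theorem map_dt_levelPath (lev : ι → ℤ) (p : SmoothI ⊗[ℝ] levelAlg G lev) :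
    (levelPath G lev p).map (dt G) = levelPath G lev (pathDeriv _ p) := by
  ext α β
  exact pathDeriv_lTensor (levelEntry G lev α β) p

theorem map_primitive_levelPath (lev : ι → ℤ) (s : unitInterval)
    (p : SmoothI ⊗[ℝ] levelAlg G lev) :
    (levelPath G lev p).map (primitive G s) = levelPath G lev (pathPrim _ s p) := by
  ext α β
  exact pathPrim_lTensor (levelEntry G lev α β) s p

theorem map_evalAt_levelPath (lev : ι → ℤ) (t : unitInterval)
    (p : SmoothI ⊗[ℝ] levelAlg G lev) :
    (levelPath G lev p).map (evalAt G t) = pathEval (levelAlg G lev) t p := by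
  ext α β
  rw [Matrix.map_apply, evalAt_eq_pathEval]
  exact pathEval_lTensor (levelEntry G lev α β) t p

theorem levelPath_mem (lev : ι → ℤ) (p : SmoothI ⊗[ℝ] levelAlg G lev) (α β : ι) :
    levelPath G lev p α β ∈ pathGr G (lev β - lev α) := by
  rw [levelPath_apply]
  induction p using TensorProduct.induction_on with
  | zero => simp
  | add x y hx hy => rw [map_add]; exact Submodule.add_mem _ hx hy
  | tmul g a => exact ⟨g ⊗ₜ ⟨a.1 α β, a.2 α β⟩, by simp⟩

/-- A homogeneous element as a matrix with a single entry. -/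
def levelSingle (G : GrAlg.{v}) (lev : ι → ℤ) (α β : ι) :
    G.gr (lev β - lev α) →ₗ[ℝ] levelAlg G lev where
  toFun a := ⟨Matrix.single α β a.1, fun α' β' => by
    rw [Matrix.single_apply]
    split_ifs with h
    · rw [← h.1, ← h.2]; exact a.2
    · exact Submodule.zero_mem _⟩
  map_add' a b := Subtype.ext (Matrix.single_add α β a.1 b.1)
  map_smul' r a := Subtype.ext (Matrix.smul_single r α β a.1).symm

/-- An entry in `pathGr` lifts to a path in one finite-dimensional homogeneous piece, and matrix
units assemble these lifts. This passage lets the finite-dimensional theory apply although G itself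
may have infinite dimension. -/
theorem exists_levelPath_eq (lev : ι → ℤ) (X : Matrix ι ι (PathAlg G))
    (hX : ∀ α β, X α β ∈ pathGr G (lev β - lev α)) : ∃ x, levelPath G lev x = X := by
  choose y hy using hX
  refine ⟨∑ α, ∑ β, LinearMap.lTensor SmoothI (levelSingle G lev α β) (y α β), ?_⟩
  have h : ∀ α β α' β' (z : SmoothI ⊗[ℝ] G.gr (lev β - lev α)),
      LinearMap.lTensor SmoothI (levelEntry G lev α' β')
        (LinearMap.lTensor SmoothI (levelSingle G lev α β) z) =
      if α = α' ∧ β = β' then LinearMap.lTensor SmoothI (G.gr (lev β - lev α)).subtype z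
        else 0 := by
    intro α β α' β' z
    induction z using TensorProduct.induction_on with
    | zero => simp
    | add x y hx hy => simp only [map_add, hx, hy]; split_ifs <;> simp
    | tmul g a =>
      simp only [LinearMap.lTensor_tmul, levelEntry_apply]
      change g ⊗ₜ (Matrix.single α β a.1) α' β' = _
      rw [Matrix.single_apply]
      split_ifs <;> simp
  ext α' β'
  rw [levelPath_apply]
  simp only [map_sum, h]
  rw [Finset.sum_eq_single α', Finset.sum_eq_single β']
  · simp [hy]
  · intro β _ hβ; rw [if_neg fun h => hβ h.2]
  · simp
  · intro α _ hα; exact Finset.sum_eq_zero fun β _ => if_neg fun h => hα h.1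
  · simp

/-- `U(t) = U(t, 0)` and `W(t) = U(0, t)` for the transport equation `U' = - X U`. -/
structure IsFundamental (X U W : Matrix ι ι (PathAlg G)) : Prop where
  deriv_left : U.map (dt G) = -(X * U)
  deriv_right : W.map (dt G) = W * X
  eval_left : U.map (evalAt G 0) = 1
  eval_right : W.map (evalAt G 0) = 1
  mul_left : W * U = 1
  mul_right : U * W = 1

/-- The equation is solved in `levelAlg`, then read off entrywise. Working in that algebra also
yields the degrees of the entries of U and W. -/
theorem exists_isFundamental (hG : ∀ i, FiniteDimensional ℝ (G.gr i)) (lev : ι → ℤ)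
    (X : Matrix ι ι (PathAlg G)) (hX : ∀ α β, X α β ∈ pathGr G (lev β - lev α)) :
    ∃ U W, IsFundamental X U W ∧ (∀ α β, U α β ∈ pathGr G (lev β - lev α)) ∧
      (∀ α β, W α β ∈ pathGr G (lev β - lev α)) ∧ ∀ (s t : unitInterval) (α β : ι),
        HasSeriesSum (fun q => ((-1 : ℝ) ^ q • (iteratedIntegral X s q).map (evalAt G t)) α β)
          ((U.map (evalAt G t) * W.map (evalAt G s)) α β) := by
  obtain ⟨x, rfl⟩ := exists_levelPath_eq lev X hX
  have := finiteDimensional_levelAlg hG lev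
  obtain ⟨w, g, h1, h2, h3, h4, h5, h6, h7⟩ := exists_path_fundamental x
  refine ⟨levelPath G lev w, levelPath G lev g, ⟨?_, ?_, ?_, ?_, ?_, ?_⟩, levelPath_mem lev w,
    levelPath_mem lev g, fun s t α β l => ?_⟩
  · rw [map_dt_levelPath, h1, levelPath_neg, levelPath_mul]
  · rw [map_dt_levelPath, h2, levelPath_mul]
  · rw [map_evalAt_levelPath, h3]; rfl
  · rw [map_evalAt_levelPath, h4]; rfl
  · rw [← levelPath_mul, h5, levelPath_one]
  · rw [← levelPath_mul, h6, levelPath_one]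
  · let I : ℕ → SmoothI ⊗[ℝ] levelAlg G lev :=
      fun q => Nat.rec 1 (fun _ y => pathPrim _ s (x * y)) q
    have hI : ∀ q, iteratedIntegral (levelPath G lev x) s q = levelPath G lev (I q) := by
      intro q
      induction q with
      | zero => exact (levelPath_one lev).symm
      | succ q ih => rw [iteratedIntegral, ih, ← levelPath_mul, map_primitive_levelPath]
    have := h7 s I rfl (fun _ => rfl) (l ∘ₗ levelEntry G lev α β) t
    simp only [hI, map_evalAt_levelPath]
    simp only [LinearMap.comp_apply, levelEntry_apply, Subalgebra.coe_mul] at this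
    simpa only [Matrix.smul_apply, map_smul, smul_eq_mul] using this

end graded

/-! ### Fundamental solutions of the transport equation: uniqueness and first variation. -/

section matrixPath

variable {G : GrAlg.{v}} {ι : Type}

theorem map_dt_mul [Fintype ι] (A A' : Matrix ι ι (PathAlg G)) :
    (A * A').map (dt G) = A.map (dt G) * A' + A * A'.map (dt G) := by
  ext α β
  simp only [Matrix.map_apply, Matrix.mul_apply, Matrix.add_apply, map_sum, dt_mul,
    Finset.sum_add_distrib]

theorem map_evalAt_mul [Fintype ι] (t : unitInterval) (A A' : Matrix ι ι (PathAlg G)) :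
    (A * A').map (evalAt G t) = A.map (evalAt G t) * A'.map (evalAt G t) :=
  Matrix.map_mul (f := (evalAt G t).toRingHom)

/-- A constant matrix as a matrix of paths. -/
def constMat (A : Matrix ι ι G.carrier) : Matrix ι ι (PathAlg G) := A.map (constPath G)

@[simp] theorem map_evalAt_constMat (t : unitInterval) (A : Matrix ι ι G.carrier) :
    (constMat A).map (evalAt G t) = A := by
  ext α β
  simp [constMat]

@[simp] theorem map_dt_constMat (A : Matrix ι ι G.carrier) : (constMat A).map (dt G) = 0 := by
  ext α β
  simp [constMat]

theorem map_evalAt_sub (t : unitInterval) (A A' : Matrix ι ι (PathAlg G)) :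
    (A - A').map (evalAt G t) = A.map (evalAt G t) - A'.map (evalAt G t) :=
  Matrix.map_sub _ (map_sub _) _ _

theorem map_dt_sub (A A' : Matrix ι ι (PathAlg G)) :
    (A - A').map (dt G) = A.map (dt G) - A'.map (dt G) :=
  Matrix.map_sub _ (map_sub _) _ _

theorem eq_constMat_of_map_dt_eq_zero {A : Matrix ι ι (PathAlg G)} (hA : A.map (dt G) = 0)
    (s : unitInterval) : A = constMat (A.map (evalAt G s)) := by
  ext α β
  have h := primitive_dt s (A α β)
  have h' : dt G (A α β) = 0 := congrFun (congrFun hA α) β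
  rw [h', map_zero, eq_comm, sub_eq_zero] at h
  exact h

/-- The integral over `[0, 1]` of a matrix of paths. -/
def matIntegral : Matrix ι ι (PathAlg G) →ₗ[ℝ] Matrix ι ι G.carrier where
  toFun A := (A.map (primitive G 0)).map (evalAt G 1)
  map_add' A A' := by ext; simp
  map_smul' r A := by ext; simp

theorem matIntegral_apply (A : Matrix ι ι (PathAlg G)) (α β : ι) :
    matIntegral A α β = evalAt G 1 (primitive G 0 (A α β)) := rfl

theorem matIntegral_constMat_mul [Fintype ι] (C : Matrix ι ι G.carrier) (A : Matrix ι ι (PathAlg G)) :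
    matIntegral (constMat C * A) = C * matIntegral A := by
  ext α β
  simp only [matIntegral_apply, Matrix.mul_apply, constMat, Matrix.map_apply, map_sum,
    primitive_const_mul, map_mul, evalAt_constPath]

theorem matIntegral_mul_constMat [Fintype ι] (A : Matrix ι ι (PathAlg G)) (C : Matrix ι ι G.carrier) :
    matIntegral (A * constMat C) = matIntegral A * C := by
  ext α β
  simp only [matIntegral_apply, Matrix.mul_apply, constMat, Matrix.map_apply, map_sum,
    primitive_mul_const, map_mul, evalAt_constPath]

theorem matIntegral_map_dt (A : Matrix ι ι (PathAlg G)) :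
    matIntegral (A.map (dt G)) = A.map (evalAt G 1) - A.map (evalAt G 0) := by
  ext α β
  simp [matIntegral_apply, primitive_dt]

theorem map_evalAt_one [DecidableEq ι] (t : unitInterval) :
    (1 : Matrix ι ι (PathAlg G)).map (evalAt G t) = 1 :=
  Matrix.map_one _ (map_zero _) (map_one _)

theorem matMul_mem [Fintype ι] {lev : ι → ℤ} {i j : ℤ} {A A' : Matrix ι ι (PathAlg G)}
    (hA : ∀ α β, A α β ∈ pathGr G (lev β - lev α + i))
    (hA' : ∀ α β, A' α β ∈ pathGr G (lev β - lev α + j)) (α β : ι) :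
    (A * A') α β ∈ pathGr G (lev β - lev α + (i + j)) := by
  rw [Matrix.mul_apply]
  refine Submodule.sum_mem _ fun γ _ => ?_
  have := pathGr_mul (hA α γ) (hA' γ β)
  convert this using 2
  ring

variable [Fintype ι] [DecidableEq ι]

namespace IsFundamental

variable {X U W : Matrix ι ι (PathAlg G)}

/-- The product W Y has zero derivative and initial value 1, so it is 1; multiplying by U gives Y =
U. -/
theorem eq_of_deriv (h : IsFundamental X U W) {Y : Matrix ι ι (PathAlg G)}
    (hY : Y.map (dt G) = -(X * Y)) (h0 : Y.map (evalAt G 0) = 1) : Y = U := by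
  have h1 : (W * Y).map (dt G) = 0 := by
    rw [map_dt_mul, h.deriv_right, hY, mul_neg, mul_assoc, add_neg_cancel]
  have h2 := eq_constMat_of_map_dt_eq_zero h1 0
  rw [map_evalAt_mul, h.eval_right, h0, mul_one] at h2
  have h3 : (constMat (1 : Matrix ι ι G.carrier)) = 1 :=
    Matrix.map_one _ (map_zero _) (map_one _)
  rw [h3] at h2
  rw [← one_mul Y, ← h.mul_right, mul_assoc, h2, mul_one]

theorem unique {U' W' : Matrix ι ι (PathAlg G)} (h : IsFundamental X U W)
    (h' : IsFundamental X U' W') : U' = U ∧ W' = W := by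
  have h1 := h.eq_of_deriv h'.deriv_left h'.eval_left
  refine ⟨h1, ?_⟩
  rw [← mul_one W', ← h.mul_right, ← h1, ← mul_assoc, h'.mul_left, one_mul]

/-- Variation of constants. -/
theorem perturb (h : IsFundamental X U W) {Y U' W' : Matrix ι ι (PathAlg G)}
    (h' : IsFundamental (X + Y) U' W') : IsFundamental (W * Y * U) (W * U') (W' * U) where
  deriv_left := by
    rw [map_dt_mul, h.deriv_right, h'.deriv_left, show W * Y * U * (W * U') =
      W * Y * (U * W) * U' by simp only [mul_assoc], h.mul_right]
    noncomm_ring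
  deriv_right := by
    rw [map_dt_mul, h'.deriv_right, h.deriv_left, show W' * U * (W * Y * U) =
      W' * (U * W) * Y * U by simp only [mul_assoc], h.mul_right]
    noncomm_ring
  eval_left := by rw [map_evalAt_mul, h.eval_right, h'.eval_left, mul_one]
  eval_right := by rw [map_evalAt_mul, h.eval_left, h'.eval_right, mul_one]
  mul_left := by
    rw [show W' * U * (W * U') = W' * (U * W) * U' by simp only [mul_assoc], h.mul_right,
      mul_one, h'.mul_left]
  mul_right := by
    rw [show W * U' * (W' * U) = W * (U' * W') * U by simp only [mul_assoc], h'.mul_right,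
      mul_one, h.mul_left]

/-- By uniqueness the given pair is the one built from the series, so any explicitly found solution
inherits the expansion. -/
theorem hasSeriesSum (h : IsFundamental X U W) (hG : ∀ i, FiniteDimensional ℝ (G.gr i))
    {lev : ι → ℤ} (hX : ∀ α β, X α β ∈ pathGr G (lev β - lev α)) (s t : unitInterval)
    (α β : ι) :
    HasSeriesSum (fun q => ((-1 : ℝ) ^ q • (iteratedIntegral X s q).map (evalAt G t)) α β)
      ((U.map (evalAt G t) * W.map (evalAt G s)) α β) := by
  obtain ⟨U', W', h', -, -, hs⟩ := exists_isFundamental hG lev X hX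
  obtain ⟨rfl, rfl⟩ := h.unique h'
  exact hs s t α β

theorem mem (h : IsFundamental X U W) (hG : ∀ i, FiniteDimensional ℝ (G.gr i))
    {lev : ι → ℤ} (hX : ∀ α β, X α β ∈ pathGr G (lev β - lev α)) :
    (∀ α β, U α β ∈ pathGr G (lev β - lev α)) ∧ ∀ α β, W α β ∈ pathGr G (lev β - lev α) := by
  obtain ⟨U', W', h', hU, hW, -⟩ := exists_isFundamental hG lev X hX
  obtain ⟨rfl, rfl⟩ := h.unique h'
  exact ⟨hU, hW⟩

end IsFundamental

theorem iteratedIntegral_smul (r : ℝ) (X : Matrix ι ι (PathAlg G)) (s : unitInterval) (q : ℕ) :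
    iteratedIntegral (r • X) s q = r ^ q • iteratedIntegral X s q := by
  induction q with
  | zero => simp [iteratedIntegral]
  | succ q ih =>
    rw [iteratedIntegral, ih, smul_mul_smul_comm, ← pow_succ']
    ext α β
    simp [iteratedIntegral]

/-- The first variation of the transport along a straight line of connections. -/
theorem hasDerivative_transport (hG : ∀ i, FiniteDimensional ℝ (G.gr i)) {lev : ι → ℤ}
    {X Y U W : Matrix ι ι (PathAlg G)} (hX : ∀ α β, X α β ∈ pathGr G (lev β - lev α))
    (hY : ∀ α β, Y α β ∈ pathGr G (lev β - lev α)) (h : IsFundamental X U W)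
    (U' W' : ℝ → Matrix ι ι (PathAlg G)) (h' : ∀ s, IsFundamental (X + s • Y) (U' s) (W' s))
    (α β : ι) : HasDerivative (fun s => (U' s).map (evalAt G 1) α β)
      ((-(U.map (evalAt G 1) * matIntegral (W * Y * U))) α β) 0 := by
  obtain ⟨hU, hW⟩ := h.mem hG hX
  have hWYU : ∀ α β, (W * Y * U) α β ∈ pathGr G (lev β - lev α) := by
    simpa using matMul_mem (matMul_mem (i := 0) (j := 0) (by simpa using hW) (by simpa using hY))
      (j := 0) (by simpa using hU)
  -- W U'(s) is the transport for s W Y U. Its iterated integrals of order q carry s^q, so its value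
  -- at 1 is a power series in s whose linear coefficient is -∫ W Y U.
  have hZ : ∀ γ δ, HasDerivative (fun s => (W * U' s).map (evalAt G 1) γ δ)
      (-(matIntegral (W * Y * U) γ δ)) 0 := by
    intro γ δ l
    have hs : ∀ s : ℝ, HasSum (fun q => s ^ q * ((-1) ^ q *
        l (evalAt G 1 (iteratedIntegral (W * Y * U) 0 q γ δ))))
        (l ((W * U' s).map (evalAt G 1) γ δ)) := fun s => by
      have h1 := h.perturb (h' s)
      have e : W * s • Y * U = s • (W * Y * U) := by
        rw [mul_smul_comm, smul_mul_assoc]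
      rw [e] at h1
      have h2 := h1.hasSeriesSum hG (lev := lev)
        (fun α β => Submodule.smul_mem _ s (hWYU α β)) 0 1 γ δ l
      rw [h1.eval_right, mul_one] at h2
      have h3 : ∀ q, l (((-1 : ℝ) ^ q •
          (iteratedIntegral (s • (W * Y * U)) 0 q).map (evalAt G 1)) γ δ) =
          s ^ q * ((-1) ^ q * l (evalAt G 1 (iteratedIntegral (W * Y * U) 0 q γ δ))) := fun q => by
        rw [iteratedIntegral_smul]
        simp only [Matrix.smul_apply, Matrix.map_apply, map_smul, smul_eq_mul]
        ring
      simpa only [h3] using h2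
    have := hasDerivAt_zero_of_hasSum_pow hs
    simpa [iteratedIntegral, matIntegral_apply] using this
  have he : ∀ s, (U' s).map (evalAt G 1) =
      U.map (evalAt G 1) * (W * U' s).map (evalAt G 1) := fun s => by
    rw [← map_evalAt_mul, ← mul_assoc, h.mul_right, one_mul]
  simp only [he, Matrix.mul_apply, Matrix.neg_apply]
  rw [← Finset.sum_neg_distrib]
  simp only [← mul_neg]
  exact HasDerivative.sum fun γ _ =>
    (hZ γ β).map (LinearMap.mulLeft ℝ ((U.map (evalAt G 1)) α γ))

end matrixPath

/-! ## Signs -/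

section sign

variable {ι : Type} [DecidableEq ι]

/-- The diagonal matrix with entries `(-1)^α`. -/
def signMat (R : Type*) [Ring R] [Algebra ℝ R] (lev : ι → ℤ) : Matrix ι ι R :=
  Matrix.diagonal fun α => algebraMap ℝ R ((-1) ^ lev α)

variable {R : Type*} [Ring R] [Algebra ℝ R] (lev : ι → ℤ)

theorem signMat_mul_apply [Fintype ι] (A : Matrix ι ι R) (α β : ι) :
    (signMat R lev * A) α β = (-1 : ℝ) ^ lev α • A α β := by
  rw [signMat, Matrix.diagonal_mul, Algebra.smul_def]

theorem mul_signMat_apply [Fintype ι] (A : Matrix ι ι R) (α β : ι) :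
    (A * signMat R lev) α β = (-1 : ℝ) ^ lev β • A α β := by
  rw [signMat, Matrix.mul_diagonal, Algebra.smul_def, Algebra.commutes]

theorem signMat_mul_signMat [Fintype ι] : signMat R lev * signMat R lev = 1 := by
  ext α β
  rw [signMat_mul_apply, signMat, Matrix.diagonal_apply, Matrix.one_apply]
  split_ifs with h
  · rw [Algebra.smul_def, ← map_mul, neg_one_sq_zpow, map_one]
  · rw [smul_zero]

theorem map_signMat {S : Type*} [Ring S] [Algebra ℝ S] (f : R →ₐ[ℝ] S) :
    (signMat R lev).map f = signMat S lev := by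
  rw [signMat, Matrix.diagonal_map (map_zero f)]
  congr 1
  ext α
  exact f.commutes _

end sign

/-! ## The Wilson line as a transport -/

section wilson

variable {M : NQAlg.{u}} {Λ : TestAlg.{v}} {ι : Type}

namespace SuperCurve

variable (φ : SuperCurve M Λ)

/-- `φ.dtheta` as a linear map. -/
def dthetaLin : M.carrier →ₗ[ℝ] PathAlg Λ.toGrAlg := OddExt.soul ∘ₗ φ.toHom.toLinearMap

/-- `φ.fld` as a linear map. -/
def fldLin : M.carrier →ₗ[ℝ] PathAlg Λ.toGrAlg := OddExt.body ∘ₗ φ.toHom.toLinearMap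

theorem dthetaLin_apply (f : M.carrier) : φ.dthetaLin f = φ.dtheta f := rfl

theorem fldLin_apply (f : M.carrier) : φ.fldLin f = φ.fld f := rfl

theorem dtheta_mem {i : ℤ} {f : M.carrier} (hf : f ∈ M.gr (i + 1)) :
    φ.dtheta f ∈ pathGr Λ.toGrAlg i := by
  have := φ.soul_mem hf
  rwa [add_sub_cancel_right] at this

theorem map_dtheta_line (T T' : Matrix ι ι M.carrier) (s : ℝ) :
    (T + s • T').map φ.dtheta = T.map φ.dtheta + s • T'.map φ.dtheta := by
  ext α β
  simp [← dthetaLin_apply]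

end SuperCurve

theorem QRep.deltaT_mem [Fintype ι] (E : QRep M ι) {ε : Matrix ι ι M.carrier}
    (hε : ∀ α β, ε α β ∈ M.gr (E.lev β - E.lev α)) (α β : ι) :
    E.deltaT ε α β ∈ M.gr (E.lev β - E.lev α + 1) := by
  refine Submodule.sub_mem _ (Submodule.add_mem _ (M.Q_mem (hε α β))
    (Submodule.sum_mem _ fun γ _ => ?_))
    (Submodule.sum_mem _ fun γ _ => Submodule.smul_mem _ _ ?_)
  · have := SetLike.mul_mem_graded (E.T_mem α γ) (hε γ β)
    convert this using 2
    ring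
  · have := SetLike.mul_mem_graded (hε α γ) (E.T_mem γ β)
    convert this using 2
    ring

variable [Fintype ι] [DecidableEq ι] (φ : SuperCurve M Λ)

theorem exists_fundamental_dtheta {lev : ι → ℤ} {T : Matrix ι ι M.carrier}
    (hT : ∀ α β, T α β ∈ M.gr (lev β - lev α + 1)) :
    ∃ U W, IsFundamental (T.map φ.dtheta) U W := by
  obtain ⟨U, W, h, -⟩ := exists_isFundamental Λ.finite lev (T.map φ.dtheta)
    (fun α β => φ.dtheta_mem (hT α β))
  exact ⟨U, W, h⟩

theorem hasSeriesSum_wilsonTerm {lev : ι → ℤ} {T : Matrix ι ι M.carrier}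
    (hT : ∀ α β, T α β ∈ M.gr (lev β - lev α + 1)) {U W : Matrix ι ι (PathAlg Λ.toGrAlg)}
    (h : IsFundamental (T.map φ.dtheta) U W) (t s : unitInterval) (α β : ι) :
    HasSeriesSum (fun q => wilsonTerm T φ t s q α β)
      ((U.map (evalAt _ t) * W.map (evalAt _ s)) α β) :=
  h.hasSeriesSum Λ.finite (lev := lev) (fun α β => φ.dtheta_mem (hT α β)) s t α β

theorem wilson_eq {lev : ι → ℤ} {T : Matrix ι ι M.carrier}
    (hT : ∀ α β, T α β ∈ M.gr (lev β - lev α + 1)) {U W : Matrix ι ι (PathAlg Λ.toGrAlg)}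
    (h : IsFundamental (T.map φ.dtheta) U W) (t s : unitInterval) :
    wilson T φ t s = U.map (evalAt _ t) * W.map (evalAt _ s) := by
  ext α β
  exact (hasSeriesSum_wilsonTerm φ hT h t s α β).seriesSum_eq

theorem hasSeriesSum_wilson {lev : ι → ℤ} {T : Matrix ι ι M.carrier}
    (hT : ∀ α β, T α β ∈ M.gr (lev β - lev α + 1)) (t s : unitInterval) (α β : ι) :
    HasSeriesSum (fun q => wilsonTerm T φ t s q α β) (wilson T φ t s α β) := by
  obtain ⟨U, W, h⟩ := exists_fundamental_dtheta φ hT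
  rw [wilson_eq φ hT h]
  exact hasSeriesSum_wilsonTerm φ hT h t s α β

theorem hasDerivative_wilson {lev : ι → ℤ} {T T' : Matrix ι ι M.carrier}
    (hT : ∀ α β, T α β ∈ M.gr (lev β - lev α + 1))
    (hT' : ∀ α β, T' α β ∈ M.gr (lev β - lev α + 1)) {U W : Matrix ι ι (PathAlg Λ.toGrAlg)}
    (h : IsFundamental (T.map φ.dtheta) U W) (α β : ι) :
    HasDerivative (fun s : ℝ => wilson (T + s • T') φ 1 0 α β)
      ((-(U.map (evalAt _ 1) * matIntegral (W * T'.map φ.dtheta * U))) α β) 0 := by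
  have hTs : ∀ (s : ℝ) α β, (T + s • T') α β ∈ M.gr (lev β - lev α + 1) := fun s α β =>
    Submodule.add_mem _ (hT α β) (Submodule.smul_mem _ s (hT' α β))
  choose U' W' h' using fun s => exists_fundamental_dtheta φ (hTs s)
  have e : ∀ s, wilson (T + s • T') φ 1 0 = (U' s).map (evalAt _ 1) := fun s => by
    rw [wilson_eq φ (hTs s) (h' s), (h' s).eval_right, mul_one]
  simp only [e]
  exact hasDerivative_transport Λ.finite (fun α β => φ.dtheta_mem (hT α β))
    (Y := T'.map φ.dtheta) (fun α β => φ.dtheta_mem (hT' α β)) h U' W'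
    (fun s => φ.map_dtheta_line T T' s ▸ h' s) α β

/-- Since U(1,t) = U(1)W(t) and U(t,0) = U(t), the integrand is the value at t of a smooth path of
matrices, and the constant factor U(1) leaves the integral. -/
theorem hasIntegral01_transgression (E : QRep M ι) (ε : Matrix ι ι M.carrier)
    {U W : Matrix ι ι (PathAlg Λ.toGrAlg)} (h : IsFundamental (E.T.map φ.dtheta) U W) (α β : ι) :
    HasIntegral01 (fun t => transgressionIntegrand E ε φ t α β)
      ((U.map (evalAt _ 1) *
        matIntegral (W * (signMat (PathAlg Λ.toGrAlg) E.lev * ε.map φ.dtheta) * U)) α β) := by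
  have e : ∀ t, transgressionIntegrand E ε φ t = (constMat (U.map (evalAt _ 1)) *
      (W * (signMat (PathAlg Λ.toGrAlg) E.lev * ε.map φ.dtheta) * U)).map (evalAt _ t) := fun t => by
    have h1 : (Matrix.of fun δ γ => (-1 : ℝ) ^ E.lev δ • evalAt Λ.toGrAlg t (φ.dtheta (ε δ γ))) =
        (signMat _ E.lev * ε.map φ.dtheta).map (evalAt _ t) := by
      ext δ γ
      rw [Matrix.map_apply, signMat_mul_apply, map_smul]
      rfl
    rw [transgressionIntegrand, wilson_eq φ E.T_mem h, wilson_eq φ E.T_mem h, h1, h.eval_right,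
      mul_one, map_evalAt_mul _ (constMat _), map_evalAt_mul _ (W * _), map_evalAt_mul _ W,
      map_evalAt_constMat]
    simp only [mul_assoc]
  rw [← matIntegral_constMat_mul, matIntegral_apply, evalAt_eq_pathEval]
  simp only [e, Matrix.map_apply, evalAt_eq_pathEval]
  exact hasIntegral01_pathEval _

theorem transgression_eq (E : QRep M ι) (ε : Matrix ι ι M.carrier)
    {U W : Matrix ι ι (PathAlg Λ.toGrAlg)} (h : IsFundamental (E.T.map φ.dtheta) U W) :
    transgression E ε φ = U.map (evalAt _ 1) *
      matIntegral (W * (signMat (PathAlg Λ.toGrAlg) E.lev * ε.map φ.dtheta) * U) := by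
  ext α β
  exact (hasIntegral01_transgression φ E ε h α β).integral01_eq

end wilson

/-! ## Matrices with entries in `Λ[τ]` -/

section extMat

variable (Λ : TestAlg.{v}) {ι : Type}

theorem evalAt_pathInl (t : unitInterval) (p : PathAlg Λ.toGrAlg) :
    evalAt Λ.ext.toGrAlg t (pathInl Λ p) = Λ.extInl (evalAt Λ.toGrAlg t p) := by
  rw [evalAt_eq_pathEval, evalAt_eq_pathEval]
  exact pathEval_lTensor Λ.extInl.toLinearMap t p

theorem evalAt_pathInr (t : unitInterval) (p : PathAlg Λ.toGrAlg) :
    evalAt Λ.ext.toGrAlg t (pathInr Λ p) = Λ.extInr (evalAt Λ.toGrAlg t p) := by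
  rw [evalAt_eq_pathEval, evalAt_eq_pathEval]
  exact pathEval_lTensor Λ.extInr t p

theorem dt_pathInl (p : PathAlg Λ.toGrAlg) :
    dt Λ.ext.toGrAlg (pathInl Λ p) = pathInl Λ (dt Λ.toGrAlg p) :=
  pathDeriv_lTensor Λ.extInl.toLinearMap p

theorem dt_pathInr (p : PathAlg Λ.toGrAlg) :
    dt Λ.ext.toGrAlg (pathInr Λ p) = pathInr Λ (dt Λ.toGrAlg p) :=
  pathDeriv_lTensor Λ.extInr p

theorem primitive_pathInl (s : unitInterval) (p : PathAlg Λ.toGrAlg) :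
    primitive Λ.ext.toGrAlg s (pathInl Λ p) = pathInl Λ (primitive Λ.toGrAlg s p) :=
  pathPrim_lTensor Λ.extInl.toLinearMap s p

theorem primitive_pathInr (s : unitInterval) (p : PathAlg Λ.toGrAlg) :
    primitive Λ.ext.toGrAlg s (pathInr Λ p) = pathInr Λ (primitive Λ.toGrAlg s p) :=
  pathPrim_lTensor Λ.extInr s p

@[simp] theorem TestAlg.extSoul_extInl (a : Λ.carrier) : Λ.extSoul (Λ.extInl a) = 0 := rfl

@[simp] theorem TestAlg.extSoul_extInr (a : Λ.carrier) : Λ.extSoul (Λ.extInr a) = a := rfl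

/-- The matrix `A + τ B` of paths. -/
def extMat (A B : Matrix ι ι (PathAlg Λ.toGrAlg)) : Matrix ι ι (PathAlg Λ.ext.toGrAlg) :=
  A.map (pathInl Λ) + B.map (pathInr Λ)

theorem extMat_apply (A B : Matrix ι ι (PathAlg Λ.toGrAlg)) (α β : ι) :
    extMat Λ A B α β = pathInl Λ (A α β) + pathInr Λ (B α β) := rfl

/-- The matrix `A + τ B` with entries in `Λ[τ]`. -/
def extConstMat (A B : Matrix ι ι Λ.carrier) : Matrix ι ι Λ.ext.carrier :=
  A.map Λ.extInl + B.map Λ.extInr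

theorem extConstMat_apply (A B : Matrix ι ι Λ.carrier) (α β : ι) :
    extConstMat Λ A B α β = Λ.extInl (A α β) + Λ.extInr (B α β) := rfl

theorem map_extSoul_extConstMat (A B : Matrix ι ι Λ.carrier) :
    (extConstMat Λ A B).map Λ.extSoul = B := by
  ext α β
  simp [extConstMat_apply]

theorem neg_extMat (A B : Matrix ι ι (PathAlg Λ.toGrAlg)) :
    -extMat Λ A B = extMat Λ (-A) (-B) := by
  ext α β
  simp only [Matrix.neg_apply, extMat_apply, map_neg, neg_add]

theorem map_dt_extMat (A B : Matrix ι ι (PathAlg Λ.toGrAlg)) :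
    (extMat Λ A B).map (dt _) = extMat Λ (A.map (dt _)) (B.map (dt _)) := by
  ext α β
  simp only [Matrix.map_apply, extMat_apply, map_add, dt_pathInl, dt_pathInr]

theorem map_evalAt_extMat (t : unitInterval) (A B : Matrix ι ι (PathAlg Λ.toGrAlg)) :
    (extMat Λ A B).map (evalAt _ t) =
      extConstMat Λ (A.map (evalAt _ t)) (B.map (evalAt _ t)) := by
  ext α β
  simp only [Matrix.map_apply, extMat_apply, extConstMat_apply, map_add, evalAt_pathInl,
    evalAt_pathInr]

theorem matIntegral_extMat (A B : Matrix ι ι (PathAlg Λ.toGrAlg)) :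
    matIntegral (extMat Λ A B) = extConstMat Λ (matIntegral A) (matIntegral B) := by
  ext α β
  simp only [matIntegral_apply, extMat_apply, extConstMat_apply, map_add, primitive_pathInl,
    primitive_pathInr, evalAt_pathInl, evalAt_pathInr]

theorem extMat_one [DecidableEq ι] : extMat Λ (1 : Matrix ι ι (PathAlg Λ.toGrAlg)) 0 = 1 := by
  have h : pathInl Λ 1 = 1 := by
    change LinearMap.lTensor SmoothI Λ.extInl.toLinearMap (1 ⊗ₜ 1) = 1 ⊗ₜ 1
    rw [LinearMap.lTensor_tmul]
    exact congrArg _ (map_one Λ.extInl)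
  ext α β
  rw [extMat_apply, Matrix.one_apply, Matrix.one_apply, Matrix.zero_apply, map_zero, add_zero]
  split_ifs
  · exact h
  · exact map_zero _

theorem extConstMat_one [DecidableEq ι] : extConstMat Λ (1 : Matrix ι ι Λ.carrier) 0 = 1 := by
  ext α β
  rw [extConstMat_apply, Matrix.one_apply, Matrix.one_apply, Matrix.zero_apply, map_zero, add_zero]
  split_ifs
  · exact map_one _
  · exact map_zero _

variable [Fintype ι]

/-- Moving τ to the left past A produces the parity of A, and the term with two factors τ vanishes.
-/
theorem extMat_mul (A B A' B' : Matrix ι ι (PathAlg Λ.toGrAlg)) :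
    extMat Λ A B * extMat Λ A' B' = extMat Λ (A * A') (A.map (pathParity _) * B' + B * A') := by
  ext α β
  simp only [Matrix.mul_apply, extMat_apply, Matrix.add_apply, map_add, map_sum, add_mul, mul_add,
    pathInl_mul, pathInl_mul_pathInr, pathInr_mul_pathInl, pathInr_mul_pathInr, Matrix.map_apply,
    Finset.sum_add_distrib, Finset.sum_const_zero]
  abel

theorem extConstMat_mul (A B A' B' : Matrix ι ι Λ.carrier) :
    extConstMat Λ A B * extConstMat Λ A' B' =
      extConstMat Λ (A * A') (A.map Λ.parity * B' + B * A') := by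
  ext α β
  simp only [Matrix.mul_apply, extConstMat_apply, Matrix.add_apply, map_add, map_sum, add_mul,
    mul_add, map_mul, inl_mul_inr, inr_mul_inl, inr_mul_inr, Matrix.map_apply,
    Finset.sum_add_distrib, Finset.sum_const_zero]
  abel

variable [DecidableEq ι]

theorem signMat_mul_extMat (lev : ι → ℤ) (A B : Matrix ι ι (PathAlg Λ.toGrAlg)) :
    signMat _ lev * extMat Λ A B = extMat Λ (signMat _ lev * A) (signMat _ lev * B) := by
  ext α β
  simp only [extMat_apply, signMat_mul_apply, map_smul, smul_add]

end extMat

/-! ### Parity as conjugation by the matrix of signs. -/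

section parity

variable {G : GrAlg.{v}} {ι : Type} [Fintype ι] [DecidableEq ι] {lev : ι → ℤ}

theorem signMat_conj_apply {R : Type*} [Ring R] [Algebra ℝ R] (A : Matrix ι ι R) (α β : ι) :
    (signMat R lev * A * signMat R lev) α β = (-1 : ℝ) ^ (lev β - lev α) • A α β := by
  rw [mul_signMat_apply, signMat_mul_apply, smul_smul, sub_eq_add_neg, zpow_add₀ (by norm_num),
    zpow_neg, ← inv_zpow, inv_neg, inv_one]

/-- The sign (-1)^(|β| - |α| + k) factors into one sign per row, one per column and (-1)^k. All
Koszul signs thereby become matrix algebra with σ² = 1. -/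
theorem map_pathParity {k : ℤ} {A : Matrix ι ι (PathAlg G)}
    (hA : ∀ α β, A α β ∈ pathGr G (lev β - lev α + k)) :
    A.map (pathParity G) = (-1 : ℝ) ^ k • (signMat _ lev * A * signMat _ lev) := by
  ext α β
  rw [Matrix.map_apply, pathParity_of_mem (hA α β), Matrix.smul_apply, signMat_conj_apply,
    smul_smul, zpow_add₀ (by norm_num), mul_comm]

theorem map_parity {k : ℤ} {A : Matrix ι ι G.carrier}
    (hA : ∀ α β, A α β ∈ G.gr (lev β - lev α + k)) :
    A.map G.parity = (-1 : ℝ) ^ k • (signMat _ lev * A * signMat _ lev) := by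
  ext α β
  rw [Matrix.map_apply, G.parity_of_mem (hA α β), Matrix.smul_apply, signMat_conj_apply,
    smul_smul, zpow_add₀ (by norm_num), mul_comm]

theorem signMat_mul_cancel {R : Type*} [Ring R] [Algebra ℝ R] (A : Matrix ι ι R) :
    signMat R lev * (signMat R lev * A) = A := by
  rw [← mul_assoc, signMat_mul_signMat, one_mul]

theorem map_dt_signMat_mul (A : Matrix ι ι (PathAlg G)) :
    (signMat _ lev * A).map (dt G) = signMat _ lev * A.map (dt G) := by
  ext α β
  simp only [Matrix.map_apply, signMat_mul_apply, map_smul]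

theorem map_dt_mul_signMat (A : Matrix ι ι (PathAlg G)) :
    (A * signMat _ lev).map (dt G) = A.map (dt G) * signMat _ lev := by
  ext α β
  simp only [Matrix.map_apply, mul_signMat_apply, map_smul]

theorem matIntegral_signMat_mul (A : Matrix ι ι (PathAlg G)) :
    matIntegral (signMat _ lev * A) = signMat _ lev * matIntegral A := by
  ext α β
  simp only [matIntegral_apply, signMat_mul_apply, map_smul]

theorem matIntegral_mul_signMat (A : Matrix ι ι (PathAlg G)) :
    matIntegral (A * signMat _ lev) = matIntegral A * signMat _ lev := by
  ext α β
  simp only [matIntegral_apply, mul_signMat_apply, map_smul]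

end parity

/-! ## The superfields of matrices -/

section superfield

variable {M : NQAlg.{u}} {Λ : TestAlg.{v}} {ι : Type} (φ : SuperCurve M Λ)

/-- The minus sign in the τ-part comes from τθ = -θτ. -/
theorem SuperCurve.map_dtheta_shift (A : Matrix ι ι M.carrier) :
    A.map φ.shift.dtheta = extMat Λ (A.map φ.dtheta)
      (-((A.map M.Q).map φ.dtheta - (A.map φ.fld).map (dt _))) := by
  ext α β
  rw [extMat_apply, Matrix.neg_apply, map_neg, ← sub_eq_add_neg]
  rfl

variable [Fintype ι]

theorem SuperCurve.map_dtheta_mul (A A' : Matrix ι ι M.carrier) :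
    (A * A').map φ.dtheta = A.map φ.dtheta * A'.map φ.fld +
      (A.map φ.fld).map (pathParity _) * A'.map φ.dtheta := by
  ext α β
  have h : ∀ f g, φ.dthetaLin (f * g) = φ.dtheta f * φ.fld g +
      pathParity _ (φ.fld f) * φ.dtheta g := fun f g => by
    simp only [SuperCurve.dthetaLin_apply, SuperCurve.dtheta, SuperCurve.fld, map_mul,
      OddExt.soul_mul]
  simp only [Matrix.map_apply, Matrix.mul_apply, Matrix.add_apply, ← SuperCurve.dthetaLin_apply,
    map_sum]
  simp only [h, Finset.sum_add_distrib, SuperCurve.dthetaLin_apply]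

variable [DecidableEq ι] (lev : ι → ℤ)

theorem SuperCurve.map_dtheta_signMat_mul (A : Matrix ι ι M.carrier) :
    (signMat _ lev * A).map φ.dtheta = signMat _ lev * A.map φ.dtheta := by
  ext α β
  simp only [Matrix.map_apply, signMat_mul_apply, ← SuperCurve.dthetaLin_apply, map_smul]

theorem SuperCurve.map_fld_signMat_mul (A : Matrix ι ι M.carrier) :
    (signMat _ lev * A).map φ.fld = signMat _ lev * A.map φ.fld := by
  ext α β
  simp only [Matrix.map_apply, signMat_mul_apply, ← SuperCurve.fldLin_apply, map_smul]

/-- Flatness solved for QT, using σ² = 1. -/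
theorem QRep.map_Q (E : QRep M ι) :
    E.T.map M.Q = -(signMat _ E.lev * (E.T * (signMat _ E.lev * E.T))) := by
  have h : signMat _ E.lev * E.T.map M.Q + E.T * (signMat _ E.lev * E.T) = 0 := by
    ext β α
    rw [Matrix.add_apply, signMat_mul_apply, Matrix.mul_apply, Matrix.zero_apply, Matrix.map_apply]
    simp only [signMat_mul_apply, mul_smul_comm]
    exact E.flat β α
  rw [← mul_neg, ← eq_neg_of_add_eq_zero_left h, signMat_mul_cancel]

theorem QRep.deltaT_eq (E : QRep M ι) (ε : Matrix ι ι M.carrier) :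
    E.deltaT ε = ε.map M.Q + E.T * ε - signMat _ E.lev * (ε * (signMat _ E.lev * E.T)) := by
  ext β α
  rw [Matrix.sub_apply, signMat_mul_apply, Matrix.mul_apply, Matrix.add_apply, Matrix.mul_apply,
    Finset.smul_sum]
  simp only [signMat_mul_apply, mul_smul_comm, smul_smul, ← zpow_add₀ (show (-1 : ℝ) ≠ 0 by norm_num)]
  rfl

theorem SuperCurve.map_parity_fld {k : ℤ} {lev : ι → ℤ} {A : Matrix ι ι M.carrier}
    (hA : ∀ α β, A α β ∈ M.gr (lev β - lev α + k)) :
    (A.map φ.fld).map (pathParity _) =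
      (-1 : ℝ) ^ k • (signMat _ lev * A.map φ.fld * signMat _ lev) :=
  map_pathParity fun α β => φ.body_mem (hA α β)

/-- The Leibniz rule for ∂_θ is applied to QT = -σTσT. Since T has degree one above the level
grading, its parity is -σTσ. -/
theorem SuperCurve.map_dtheta_Q_T (E : QRep M ι) :
    (E.T.map M.Q).map φ.dtheta =
      E.T.map φ.fld * E.T.map φ.dtheta -
      signMat _ E.lev * E.T.map φ.dtheta * signMat _ E.lev * E.T.map φ.fld := by
  have hneg : ∀ A : Matrix ι ι M.carrier, (-A).map φ.dtheta = -A.map φ.dtheta := fun A => by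
    ext α β
    exact map_neg φ.dthetaLin _
  rw [E.map_Q, hneg, φ.map_dtheta_signMat_mul, φ.map_dtheta_mul, φ.map_parity_fld E.T_mem,
    φ.map_dtheta_signMat_mul, φ.map_fld_signMat_mul, zpow_one, neg_one_smul]
  simp only [mul_add, neg_mul, mul_neg, mul_assoc, signMat_mul_cancel]
  abel

/-- Again the Leibniz rule for ∂_θ, now with both an odd matrix T (k = 1) and an even matrix ε (k =
0). The four product terms are those that the derivatives of W and U and the end-point formulas for
their BRST differentials must match. -/
theorem SuperCurve.map_dtheta_deltaT (E : QRep M ι) {ε : Matrix ι ι M.carrier}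
    (hε : ∀ α β, ε α β ∈ M.gr (E.lev β - E.lev α)) :
    (E.deltaT ε).map φ.dtheta = (ε.map M.Q).map φ.dtheta + E.T.map φ.dtheta * ε.map φ.fld -
      signMat _ E.lev * E.T.map φ.fld * signMat _ E.lev * ε.map φ.dtheta -
      signMat _ E.lev * ε.map φ.dtheta * signMat _ E.lev * E.T.map φ.fld -
      ε.map φ.fld * E.T.map φ.dtheta := by
  have hsub : ∀ A A' : Matrix ι ι M.carrier,
      (A - A').map φ.dtheta = A.map φ.dtheta - A'.map φ.dtheta :=
    Matrix.map_sub _ (map_sub φ.dthetaLin)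
  have hadd : ∀ A A' : Matrix ι ι M.carrier,
      (A + A').map φ.dtheta = A.map φ.dtheta + A'.map φ.dtheta :=
    Matrix.map_add _ (map_add φ.dthetaLin)
  rw [E.deltaT_eq, hsub, hadd, φ.map_dtheta_signMat_mul, φ.map_dtheta_mul, φ.map_dtheta_mul,
    φ.map_parity_fld E.T_mem, φ.map_parity_fld (k := 0) (by simpa using hε),
    φ.map_dtheta_signMat_mul, φ.map_fld_signMat_mul, zpow_one, neg_one_smul, zpow_zero, one_smul]
  simp only [mul_add, neg_mul, mul_assoc, signMat_mul_cancel]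
  abel

end superfield

/-! ## The BRST differential of the Wilson line -/

section brst

variable {M : NQAlg.{u}} {Λ : TestAlg.{v}} {ι : Type} [Fintype ι] [DecidableEq ι]
  (φ : SuperCurve M Λ) (E : QRep M ι) {U W : Matrix ι ι (PathAlg Λ.toGrAlg)}

/-- The BRST differential of `U(t, 0)`. -/
def brstLeft (φ : SuperCurve M Λ) (E : QRep M ι) (U : Matrix ι ι (PathAlg Λ.toGrAlg)) :
    Matrix ι ι (PathAlg Λ.toGrAlg) :=
  signMat _ E.lev * U * signMat _ E.lev * constMat (E.T.map (φ.value 0)) - E.T.map φ.fld * U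

/-- The BRST differential of `U(0, t)`. -/
def brstRight (φ : SuperCurve M Λ) (E : QRep M ι) (W : Matrix ι ι (PathAlg Λ.toGrAlg)) :
    Matrix ι ι (PathAlg Λ.toGrAlg) :=
  signMat _ E.lev * W * signMat _ E.lev * E.T.map φ.fld - constMat (E.T.map (φ.value 0)) * W

variable {φ E}

theorem IsFundamental.map_pathParity (h : IsFundamental (E.T.map φ.dtheta) U W) :
    U.map (pathParity _) = signMat _ E.lev * U * signMat _ E.lev ∧
      W.map (pathParity _) = signMat _ E.lev * W * signMat _ E.lev := by
  obtain ⟨hU, hW⟩ := h.mem Λ.finite (fun α β => φ.dtheta_mem (E.T_mem α β))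
  constructor
  · rw [WilsonLine.map_pathParity (k := 0) (by simpa using hU), zpow_zero, one_smul]
  · rw [WilsonLine.map_pathParity (k := 0) (by simpa using hW), zpow_zero, one_smul]

/-- The transport along the shifted curve. -/
theorem IsFundamental.shift (h : IsFundamental (E.T.map φ.dtheta) U W) :
    IsFundamental (E.T.map φ.shift.dtheta) (extMat Λ U (brstLeft φ E U))
      (extMat Λ W (brstRight φ E W)) := by
  obtain ⟨U', W', h'⟩ := exists_fundamental_dtheta φ.shift E.T_mem
  obtain ⟨hU, hW⟩ := h.map_pathParity
  have hX : (E.T.map φ.dtheta).map (pathParity _) =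
      signMat _ E.lev * E.T.map φ.dtheta * signMat _ E.lev := by
    rw [WilsonLine.map_pathParity (k := 0)
      (by simpa using fun α β => φ.dtheta_mem (E.T_mem α β)), zpow_zero, one_smul]
  have hv : (E.T.map φ.fld).map (evalAt _ 0) = E.T.map (φ.value 0) := rfl
  -- By uniqueness it suffices to verify the transport equation along the shifted curve. The
  -- derivative of T(t) in `brstLeft` matches the -∂_t part of the shift, and flatness accounts for
  -- the Q part. At t = 0 the two end-point terms cancel.
  have e1 : extMat Λ U (brstLeft φ E U) = U' := by
    refine h'.eq_of_deriv ?_ ?_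
    · rw [φ.map_dtheta_shift, map_dt_extMat, extMat_mul, neg_extMat, h.deriv_left, hX,
        φ.map_dtheta_Q_T]
      congr 1
      rw [brstLeft, map_dt_sub, map_dt_mul, map_dt_mul_signMat, map_dt_signMat_mul, map_dt_mul,
        h.deriv_left, map_dt_constMat]
      simp only [mul_sub, sub_mul, mul_neg, neg_mul, mul_zero, mul_assoc, signMat_mul_cancel]
      abel
    · rw [map_evalAt_extMat, h.eval_left, brstLeft, map_evalAt_sub, map_evalAt_mul, map_evalAt_mul,
        map_evalAt_mul, map_evalAt_mul, map_evalAt_constMat, h.eval_left, map_signMat, hv, mul_one,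
        mul_one, signMat_mul_signMat, one_mul, sub_self, extConstMat_one]
  -- A left inverse of U' must be W', so no differential equation has to be checked for the second
  -- factor.
  have e2 : extMat Λ W (brstRight φ E W) * U' = 1 := by
    rw [← e1, extMat_mul, hW, brstLeft, brstRight, h.mul_left, ← extMat_one]
    congr 1
    have hWU : ∀ A, W * (U * A) = A := fun A => by rw [← mul_assoc, h.mul_left, one_mul]
    simp only [mul_sub, sub_mul, mul_assoc, signMat_mul_cancel, hWU, h.mul_left, mul_one]
    abel
  rw [e1, show extMat Λ W (brstRight φ E W) = W' by
    rw [← mul_one (extMat _ _ _), ← h'.mul_right, ← mul_assoc, e2, one_mul]]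
  exact h'

/-- Every factor of V on the shifted curve has the form A + τB with A its value on φ, and such
matrices are closed under products and integrals. The contraction of V with fibre coordinates needs
this splitting. -/
theorem exists_transgression_shift (h : IsFundamental (E.T.map φ.dtheta) U W)
    (ε : Matrix ι ι M.carrier) :
    ∃ B, transgression E ε φ.shift = extConstMat Λ (transgression E ε φ) B := by
  rw [transgression_eq φ.shift E ε h.shift, transgression_eq φ E ε h, φ.map_dtheta_shift,
    signMat_mul_extMat, extMat_mul, extMat_mul, matIntegral_extMat, map_evalAt_extMat,
    extConstMat_mul]
  exact ⟨_, rfl⟩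

theorem transgression_shift (h : IsFundamental (E.T.map φ.dtheta) U W)
    (ε : Matrix ι ι M.carrier) :
    transgression E ε φ.shift = extConstMat Λ (transgression E ε φ)
      ((transgression E ε φ.shift).map Λ.extSoul) := by
  obtain ⟨B, hB⟩ := exists_transgression_shift h ε
  rw [hB, map_extSoul_extConstMat]

/-- U and W respect the level grading, and ∂_θ lowers the degree by one. -/
theorem IsFundamental.transgression_mem (h : IsFundamental (E.T.map φ.dtheta) U W)
    {ε : Matrix ι ι M.carrier} (hε : ∀ α β, ε α β ∈ M.gr (E.lev β - E.lev α)) (α β : ι) :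
    transgression E ε φ α β ∈ Λ.gr (E.lev β - E.lev α - 1) := by
  obtain ⟨hU, hW⟩ := h.mem Λ.finite (fun α β => φ.dtheta_mem (E.T_mem α β))
  have h1 : ∀ α β, (W * (signMat (PathAlg Λ.toGrAlg) E.lev * ε.map φ.dtheta) * U) α β ∈
      pathGr Λ.toGrAlg (E.lev β - E.lev α + (0 + -1 + 0)) :=
    matMul_mem (matMul_mem (by simpa using hW) fun α β => by
      rw [signMat_mul_apply]
      exact Submodule.smul_mem _ _ (φ.soul_mem (hε α β))) (by simpa using hU)
  rw [transgression_eq φ E ε h, Matrix.mul_apply]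
  refine Submodule.sum_mem _ fun γ _ => ?_
  have := SetLike.mul_mem_graded (evalAt_mem (hU α γ) 1) (evalAt_mem (primitive_mem (h1 γ β) 0) 1)
  rwa [show E.lev γ - E.lev α + (E.lev β - E.lev γ + (0 + -1 + 0)) = E.lev β - E.lev α - 1 by
    ring] at this

/-- The BRST differential of `V`. -/
theorem brst_transgression (h : IsFundamental (E.T.map φ.dtheta) U W) {ε : Matrix ι ι M.carrier}
    (hε : ∀ α β, ε α β ∈ M.gr (E.lev β - E.lev α)) :
    -(U.map (evalAt _ 1) * matIntegral (W * (E.deltaT ε).map φ.dtheta * U)) =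
      -(ε.map (φ.value 1) * U.map (evalAt _ 1)) + U.map (evalAt _ 1) * ε.map (φ.value 0) +
      signMat _ E.lev * (transgression E ε φ.shift).map Λ.extSoul +
      signMat _ E.lev * (E.T.map (φ.value 1) * transgression E ε φ) +
      transgression E ε φ * signMat _ E.lev * E.T.map (φ.value 0) := by
  obtain ⟨hU, hW⟩ := h.mem Λ.finite (fun α β => φ.dtheta_mem (E.T_mem α β))
  obtain ⟨hU', hW'⟩ := h.map_pathParity
  have hvT : (E.T.map φ.fld).map (evalAt _ 1) = E.T.map (φ.value 1) := rfl
  have hve : ∀ t, (ε.map φ.fld).map (evalAt _ t) = ε.map (φ.value t) := fun t => rfl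
  -- The factor ∂_θε has degree -1 relative to the levels, which gives the extra sign when τ is
  -- moved past it.
  have hWe : (W * (signMat _ E.lev * ε.map φ.dtheta)).map (pathParity _) =
      -(signMat _ E.lev * (W * (signMat _ E.lev * ε.map φ.dtheta)) * signMat _ E.lev) := by
    rw [WilsonLine.map_pathParity (k := 0 + -1) (matMul_mem (by simpa using hW) fun α β => ?_)]
    · norm_num
    · rw [signMat_mul_apply]
      exact Submodule.smul_mem _ _ (φ.soul_mem (hε α β))
  have hU1 : (U.map (evalAt _ 1)).map Λ.parity =
      signMat _ E.lev * U.map (evalAt _ 1) * signMat _ E.lev := by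
    rw [map_parity (k := 0) fun α β => ?_, zpow_zero, one_smul]
    simpa using evalAt_mem (hU α β) 1
  -- This total derivative is the source of the end-point terms with ε(1) and ε(0).
  have hd : matIntegral ((W * ε.map φ.fld * U).map (dt _)) =
      W.map (evalAt _ 1) * ε.map (φ.value 1) * U.map (evalAt _ 1) - ε.map (φ.value 0) := by
    rw [matIntegral_map_dt, map_evalAt_mul, map_evalAt_mul, map_evalAt_mul, map_evalAt_mul,
      h.eval_left, h.eval_right, hve, hve, one_mul, mul_one]
  have hUW : ∀ A, U.map (evalAt _ 1) * (W.map (evalAt _ 1) * A) = A := fun A => by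
    rw [← mul_assoc, ← map_evalAt_mul, h.mul_right, map_evalAt_one, one_mul]
  -- The left side is the τ-coefficient of Wσ(∂_θε)U on the shifted curve, one term per factor. The
  -- terms with T(t) coming from δ_B W and δ_B U match those in ∂_θ(δ_εT), so outside the total
  -- derivative and ∂_θ(δ_εT) only T(0) remains.
  have key : W.map (pathParity _) * (signMat _ E.lev *
        -((ε.map M.Q).map φ.dtheta - (ε.map φ.fld).map (dt _))) * U +
      brstRight φ E W * (signMat _ E.lev * ε.map φ.dtheta) * U +
      (W * (signMat _ E.lev * ε.map φ.dtheta)).map (pathParity _) * brstLeft φ E U =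
      signMat _ E.lev * ((W * ε.map φ.fld * U).map (dt _) -
        W * (E.deltaT ε).map φ.dtheta * U) -
      signMat _ E.lev * (W * (signMat _ E.lev * ε.map φ.dtheta) * U) * signMat _ E.lev *
        constMat (E.T.map (φ.value 0)) -
      constMat (E.T.map (φ.value 0)) * (W * (signMat _ E.lev * ε.map φ.dtheta) * U) := by
    rw [map_dt_mul, map_dt_mul, h.deriv_left, h.deriv_right, φ.map_dtheta_deltaT E hε, hW', hWe,
      brstLeft, brstRight]
    simp only [mul_sub, sub_mul, mul_add, add_mul, mul_neg, neg_mul, mul_assoc, signMat_mul_cancel]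
    abel
  -- Product rule for V = U(1)∫Wσ(∂_θε)U: first τ passes U(1), which is conjugated by σ, then U(1)
  -- itself is varied.
  have hV : (transgression E ε φ.shift).map Λ.extSoul =
      signMat _ E.lev * U.map (evalAt _ 1) * signMat _ E.lev *
        (signMat _ E.lev * (W.map (evalAt _ 1) * ε.map (φ.value 1) * U.map (evalAt _ 1) -
            ε.map (φ.value 0) - matIntegral (W * (E.deltaT ε).map φ.dtheta * U)) -
          signMat _ E.lev * matIntegral (W * (signMat _ E.lev * ε.map φ.dtheta) * U) *
            signMat _ E.lev * E.T.map (φ.value 0) -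
          E.T.map (φ.value 0) * matIntegral (W * (signMat _ E.lev * ε.map φ.dtheta) * U)) +
      (signMat _ E.lev * U.map (evalAt _ 1) * signMat _ E.lev * E.T.map (φ.value 0) -
        E.T.map (φ.value 1) * U.map (evalAt _ 1)) *
          matIntegral (W * (signMat _ E.lev * ε.map φ.dtheta) * U) := by
    rw [transgression_eq φ.shift E ε h.shift, φ.map_dtheta_shift, signMat_mul_extMat, extMat_mul,
      extMat_mul, matIntegral_extMat, map_evalAt_extMat, extConstMat_mul, map_extSoul_extConstMat,
      hU1, add_mul _ _ U, add_comm (_ * brstLeft φ E U), key, map_sub, map_sub,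
      matIntegral_mul_constMat, matIntegral_constMat_mul, matIntegral_mul_signMat,
      matIntegral_signMat_mul, matIntegral_signMat_mul, map_sub, hd, brstLeft, map_evalAt_sub,
      map_evalAt_mul _ (_ * _ * _), map_evalAt_mul _ (_ * _), map_evalAt_mul _ (signMat _ _),
      map_evalAt_mul, map_evalAt_constMat, map_signMat, hvT]
  rw [hV, transgression_eq φ E ε h]
  simp only [mul_sub, sub_mul, mul_add, mul_assoc, signMat_mul_cancel, hUW]
  abel

end brst

/-! ## Contraction with fibre coordinates -/

section sandwich

variable {M : NQAlg.{u}} {Λ : TestAlg.{v}} {ι : Type} [Fintype ι]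

theorem sandwich_eq (z : ι → Λ.carrier) (A : Matrix ι ι Λ.carrier) (w : ι → Λ.carrier) :
    sandwich z A w = Matrix.vecMul z A ⬝ᵥ w := by
  simp only [sandwich, dotProduct, Matrix.vecMul, Finset.sum_mul]
  exact Finset.sum_comm

theorem sandwich_vecMul (z : ι → Λ.carrier) (A B : Matrix ι ι Λ.carrier) (w : ι → Λ.carrier) :
    sandwich (Matrix.vecMul z A) B w = sandwich z (A * B) w := by
  rw [sandwich_eq, sandwich_eq, Matrix.vecMul_vecMul]

theorem sandwich_mulVec (z : ι → Λ.carrier) (A B : Matrix ι ι Λ.carrier) (w : ι → Λ.carrier) :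
    sandwich z A (Matrix.mulVec B w) = sandwich z (A * B) w := by
  rw [sandwich_eq, sandwich_eq, ← Matrix.vecMul_vecMul, Matrix.dotProduct_mulVec]

theorem sandwich_add (z : ι → Λ.carrier) (A B : Matrix ι ι Λ.carrier) (w : ι → Λ.carrier) :
    sandwich z (A + B) w = sandwich z A w + sandwich z B w := by
  simp only [sandwich_eq, Matrix.vecMul_add, add_dotProduct]

theorem sandwich_neg (z : ι → Λ.carrier) (A : Matrix ι ι Λ.carrier) (w : ι → Λ.carrier) :
    sandwich z (-A) w = -sandwich z A w := by
  simp only [sandwich_eq, Matrix.vecMul_neg, neg_dotProduct]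

theorem HasDerivative.sandwich {A : ℝ → Matrix ι ι Λ.carrier} {A' : Matrix ι ι Λ.carrier} {s : ℝ}
    (hA : ∀ α β, HasDerivative (fun r => A r α β) (A' α β) s) (z w : ι → Λ.carrier) :
    HasDerivative (fun r => sandwich z (A r) w) (sandwich z A' w) s :=
  HasDerivative.sum fun α _ => HasDerivative.sum fun β _ =>
    (hA α β).map ((LinearMap.mulRight ℝ (w β)).comp (LinearMap.mulLeft ℝ (z α)))

/-- Expansion in r: the two linear terms contribute A(0), and the quadratic term has zero derivative
at r = 0. -/
theorem hasDerivative_sandwich {A : ℝ → Matrix ι ι Λ.carrier} {A' : Matrix ι ι Λ.carrier}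
    (hA : ∀ α β, HasDerivative (fun r => A r α β) (A' α β) 0) (z z' w w' : ι → Λ.carrier) :
    HasDerivative (fun r : ℝ => sandwich (z + r • z') (A r) (w - r • w'))
      (sandwich z A' w + sandwich z' (A 0) w - sandwich z (A 0) w') 0 := by
  have e : ∀ r : ℝ, sandwich (z + r • z') (A r) (w - r • w') =
      sandwich z (A r) w + r • sandwich z' (A r) w + (-r) • sandwich z (A r) w' +
        (-(r * r)) • sandwich z' (A r) w' := fun r => by
    simp only [sandwich_eq, Matrix.add_vecMul, Matrix.smul_vecMul, add_dotProduct, dotProduct_sub,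
      smul_dotProduct, dotProduct_smul, smul_add, mul_smul, neg_smul]
    abel
  simp only [e]
  have h1 := ((HasDerivative.sandwich hA z w).add
    (HasDerivative.smul_fun (hasDerivAt_id 0) (HasDerivative.sandwich hA z' w))).add
    (HasDerivative.smul_fun (hasDerivAt_id 0).fun_neg (HasDerivative.sandwich hA z w'))
  have h2 := h1.add (HasDerivative.smul_fun ((hasDerivAt_id 0).fun_mul (hasDerivAt_id 0)).fun_neg
    (HasDerivative.sandwich hA z' w'))
  simpa [sub_eq_add_neg] using h2

/-- Moving τ to the left past z_α gives (-1)^α; past z_α V^α_β, of degree |β| - 1, it gives -(-1)^β,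
and this minus sign cancels the one in front of w'. -/
theorem extSoul_sandwich {lev : ι → ℤ} [DecidableEq ι] {z w : ι → Λ.carrier}
    (hz : ∀ α, z α ∈ Λ.gr (lev α)) {V : Matrix ι ι Λ.carrier}
    (hV : ∀ α β, V α β ∈ Λ.gr (lev β - lev α - 1)) (V' : Matrix ι ι Λ.carrier)
    (z' w' : ι → Λ.carrier) :
    Λ.extSoul (sandwich (fun α => Λ.extInl (z α) + Λ.extInr (z' α)) (extConstMat Λ V V')
      (fun α => Λ.extInl (w α) - Λ.extInr (w' α))) =
    sandwich z' V w + sandwich z (signMat _ lev * V') w +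
      sandwich z (V * signMat _ lev) w' := by
  simp only [sandwich, map_sum, ← Finset.sum_add_distrib]
  refine Finset.sum_congr rfl fun α _ => Finset.sum_congr rfl fun β _ => ?_
  have h1 : Λ.parity (z α * V α β) = -((-1 : ℝ) ^ lev β • (z α * V α β)) := by
    rw [Λ.parity_of_mem (SetLike.mul_mem_graded (hz α) (hV α β)), ← neg_smul]
    congr 1
    rw [show lev α + (lev β - lev α - 1) = lev β - 1 by ring, zpow_sub_one₀ (by norm_num)]
    norm_num
  have e : (Λ.extInl (z α) + Λ.extInr (z' α)) * extConstMat Λ V V' α β *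
      (Λ.extInl (w β) - Λ.extInr (w' β)) = Λ.extInl (z α * V α β * w β) +
      Λ.extInr (z' α * V α β * w β + Λ.parity (z α) * V' α β * w β -
        Λ.parity (z α * V α β) * w' β) := by
    rw [extConstMat_apply]
    simp only [add_mul, mul_add, mul_sub, ← map_mul Λ.extInl, inl_mul_inr, inr_mul_inl,
      inr_mul_inr, map_add, map_sub, zero_mul]
    abel
  rw [e, map_add, TestAlg.extSoul_extInl, TestAlg.extSoul_extInr, zero_add, h1,
    Λ.parity_of_mem (hz α), signMat_mul_apply, mul_signMat_apply]
  simp only [smul_mul_assoc, mul_smul_comm, neg_mul, sub_neg_eq_add]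

end sandwich

/-! ## Solutions of the equations of motion -/

section onShell

variable {M : NQAlg.{u}} {Λ : TestAlg.{v}} {φ : SuperCurve M Λ}

theorem SuperCurve.OnShell.dtheta_eq_zero (h : φ.OnShell) {i : ℤ} (hi : i ≤ 0) {f : M.carrier}
    (hf : f ∈ M.gr i) : φ.dtheta f = 0 := by
  rcases hi.lt_or_eq with hi | rfl
  · rw [M.nonneg i hi, Submodule.mem_bot] at hf
    rw [hf]
    exact map_zero φ.dthetaLin
  · exact (h f hf).1

/-- The τ-part of an auxiliary field on the shifted curve is minus an equation of motion, so it
vanishes on solutions. Negative degrees are empty in M. -/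
theorem SuperCurve.OnShell.dtheta_shift_eq_zero (h : φ.OnShell) {i : ℤ} (hi : i ≤ 0)
    {f : M.carrier} (hf : f ∈ M.gr i) : φ.shift.dtheta f = 0 := by
  rcases hi.lt_or_eq with hi | rfl
  · rw [M.nonneg i hi, Submodule.mem_bot] at hf
    rw [hf]
    exact map_zero φ.shift.dthetaLin
  · change pathInl Λ (φ.dtheta f) - pathInr Λ (φ.dtheta (M.Q f) - dt Λ.toGrAlg (φ.fld f)) = 0
    rw [(h f hf).1, (h f hf).2, sub_self, map_zero, map_zero, sub_zero]

variable {ι : Type} [Fintype ι] [DecidableEq ι]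

/-- Block triangular matrices are closed under products and under entrywise integration. -/
theorem iteratedIntegral_eq_zero {G : GrAlg.{v}} {lev : ι → ℤ} {X : Matrix ι ι (PathAlg G)}
    (hX : ∀ α β, lev β < lev α → X α β = 0) (s : unitInterval) (q : ℕ) {α β : ι}
    (hαβ : lev β < lev α) : iteratedIntegral X s q α β = 0 := by
  induction q generalizing α β with
  | zero => exact Matrix.one_apply_ne fun h => by simp [h] at hαβ
  | succ q ih =>
    rw [iteratedIntegral, Matrix.map_apply, Matrix.mul_apply, Finset.sum_eq_zero, map_zero]
    intro γ _
    rcases lt_or_ge (lev γ) (lev α) with h | h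
    · rw [hX α γ h, zero_mul]
    · rw [ih (hαβ.trans_le h), mul_zero]

theorem wilson_eq_zero {lev : ι → ℤ} {T : Matrix ι ι M.carrier}
    (hT : ∀ α β, lev β < lev α → φ.dtheta (T α β) = 0) (t s : unitInterval) {α β : ι}
    (hαβ : lev β < lev α) : wilson T φ t s α β = 0 := by
  refine HasSeriesSum.seriesSum_eq fun l => ?_
  have h : ∀ q, wilsonTerm T φ t s q α β = 0 := fun q => by
    rw [wilsonTerm, Matrix.smul_apply, Matrix.map_apply,
      iteratedIntegral_eq_zero (X := T.map φ.dtheta) hT s q hαβ, map_zero, smul_zero]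
  simp only [h, map_zero]
  exact hasSum_zero

theorem integral01_eq_zero {V : Type*} [AddCommGroup V] [Module ℝ V] {f : unitInterval → V}
    (hf : ∀ t, f t = 0) : integral01 f = 0 := by
  refine HasIntegral01.integral01_eq fun l => ?_
  have h : (Set.IccExtend zero_le_one fun t : unitInterval => l (f t)) = fun _ => 0 := by
    ext t
    simp [Set.IccExtend, hf]
  rw [h]
  simp

/-- A nonzero contribution U^α_δ ∂_θε^δ_γ U^γ_α would need |α| ≤ |δ| < |γ| ≤ |α|. Only the vanishing
of θ-components is assumed, so that the result also applies to the shifted curve. -/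
theorem transgression_diag_eq_zero (E : QRep M ι) {ε : Matrix ι ι M.carrier}
    (hε : ∀ α β, ε α β ∈ M.gr (E.lev β - E.lev α))
    (hφ : ∀ i ≤ 0, ∀ f ∈ M.gr i, φ.dtheta f = 0) (α : ι) : transgression E ε φ α α = 0 := by
  have hw : ∀ t s {α β : ι}, E.lev β < E.lev α → wilson E.T φ t s α β = 0 :=
    fun t s {_ _} => wilson_eq_zero (lev := E.lev)
      (fun α β h => hφ _ (by omega) _ (E.T_mem α β)) t s
  refine integral01_eq_zero fun t => ?_
  rw [transgressionIntegrand, Matrix.mul_apply]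
  refine Finset.sum_eq_zero fun γ _ => ?_
  rcases lt_or_ge (E.lev α) (E.lev γ) with h | h
  · rw [hw t 0 h, mul_zero]
  rw [Matrix.mul_apply, Finset.sum_eq_zero, zero_mul]
  intro δ _
  rcases lt_or_ge (E.lev δ) (E.lev α) with h' | h'
  · rw [hw 1 t h', zero_mul]
  · rw [Matrix.of_apply, hφ _ (by omega) _ (hε δ γ), map_zero, smul_zero, mul_zero]

theorem transgression_eq_zero (E : QRep M ι) {ε : Matrix ι ι M.carrier}
    (hφ : ∀ α β, φ.dtheta (ε α β) = 0) : transgression E ε φ = 0 := by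
  ext α β
  refine integral01_eq_zero fun t => ?_
  have h : (Matrix.of fun δ γ => (-1 : ℝ) ^ E.lev δ • evalAt Λ.toGrAlg t (φ.dtheta (ε δ γ))) =
      0 := by
    ext δ γ
    rw [Matrix.of_apply, hφ, map_zero, smul_zero, Matrix.zero_apply]
  rw [transgressionIntegrand, h, mul_zero, zero_mul, Matrix.zero_apply]

end onShell

/-! ## The supertrace -/

section supertrace

variable {G : GrAlg.{v}} {ι : Type} [Fintype ι] {lev : ι → ℤ}

/-- The supertrace is cyclic in the graded sense. -/
theorem supertrace_comm {A B : Matrix ι ι G.carrier} {k : ℤ}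
    (hA : ∀ α β, A α β ∈ G.gr (lev β - lev α + k))
    (hB : ∀ α β, B α β ∈ G.gr (lev β - lev α - k)) :
    ∑ α, (-1 : ℝ) ^ lev α • (A * B) α α = (-1 : ℝ) ^ k • ∑ α, (-1 : ℝ) ^ lev α • (B * A) α α := by
  simp only [Matrix.mul_apply, Finset.smul_sum, smul_smul]
  rw [Finset.sum_comm]
  refine Finset.sum_congr rfl fun δ _ => Finset.sum_congr rfl fun α _ => ?_
  rw [G.comm (hA α δ) (hB δ α), smul_smul, ← zpow_add₀ (by norm_num), ← zpow_add₀ (by norm_num)]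
  congr 1
  -- With d = |δ| - |α| + k the exponent is |α| - d² = k + |δ| - d(d + 1), and d(d + 1) is even.
  obtain ⟨m, hm⟩ := Int.even_mul_succ_self (lev δ - lev α + k)
  rw [show lev α + (lev δ - lev α + k) * (lev α - lev δ - k) =
    (k + lev δ) + ((-m) + (-m)) by linear_combination -hm, zpow_add₀ (by norm_num),
    TestAlg.neg_one_zpow_even, mul_one]

end supertrace

/-! ## The main theorem -/

section main

variable {M : NQAlg.{u}} {ι : Type} [Fintype ι] [DecidableEq ι] {E : QRep M ι}
  {ε : Matrix ι ι M.carrier} {Λ : TestAlg.{v}}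

/-- The right-hand side of the formula for `δ_ε U(1, 0)`. -/
def wilsonVariation (E : QRep M ι) (ε : Matrix ι ι M.carrier) (φ : SuperCurve M Λ) :
    Matrix ι ι Λ.carrier :=
  -(ε.map (φ.value 1) * wilson E.T φ 1 0) + wilson E.T φ 1 0 * ε.map (φ.value 0) +
    signMat _ E.lev * (transgression E ε φ.shift).map Λ.extSoul +
    signMat _ E.lev * (E.T.map (φ.value 1) * transgression E ε φ) +
    transgression E ε φ * signMat _ E.lev * E.T.map (φ.value 0)

theorem hasDerivative_wilsonVariation (hε : ∀ α β, ε α β ∈ M.gr (E.lev β - E.lev α))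
    (φ : SuperCurve M Λ) (α β : ι) :
    HasDerivative (fun s : ℝ => wilson (E.T + s • E.deltaT ε) φ 1 0 α β)
      (wilsonVariation E ε φ α β) 0 := by
  obtain ⟨U, W, h⟩ := exists_fundamental_dtheta φ E.T_mem
  have h1 := hasDerivative_wilson φ E.T_mem (E.deltaT_mem hε) h α β
  rwa [brst_transgression h hε, show U.map (evalAt _ 1) = wilson E.T φ 1 0 by
    rw [wilson_eq φ E.T_mem h, h.eval_right, mul_one]] at h1

/-- The variations of the two fibre coordinates cancel the terms with ε(1) and ε(0) in
`wilsonVariation`; the terms with T(1) and T(0) are what δ_B of the fibre coordinates contributes to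
δ_B(ζVζ). -/
theorem hasDerivative_changedSection (hε : ∀ α β, ε α β ∈ M.gr (E.lev β - E.lev α))
    (p : FramedCurve M E Λ) :
    HasDerivative (changedSection E ε p)
      (deltaBHat (fun (Λ' : TestAlg.{v}) (p' : FramedCurve M E Λ') =>
        sandwich p'.z (transgression E ε p'.toSuperCurve) p'.w) Λ p) 0 := by
  obtain ⟨U, W, h⟩ := exists_fundamental_dtheta p.toSuperCurve E.T_mem
  have h1 := hasDerivative_sandwich (A := fun s : ℝ => wilson (E.T + s • E.deltaT ε) _ 1 0)
    (A' := wilsonVariation E ε p.toSuperCurve)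
    (fun α β => hasDerivative_wilsonVariation hε p.toSuperCurve α β) p.z
    (Matrix.vecMul p.z (ε.map (p.value 1))) p.w (Matrix.mulVec (ε.map (p.value 0)) p.w)
  have h2 : deltaBHat (fun (Λ' : TestAlg.{v}) (p' : FramedCurve M E Λ') =>
        sandwich p'.z (transgression E ε p'.toSuperCurve) p'.w) Λ p =
      sandwich (Matrix.vecMul p.z (signMat _ E.lev * E.T.map (p.value 1)))
        (transgression E ε p.toSuperCurve) p.w +
      sandwich p.z (signMat _ E.lev *
        (transgression E ε p.toSuperCurve.shift).map Λ.extSoul) p.w +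
      sandwich p.z (transgression E ε p.toSuperCurve * signMat _ E.lev)
        (Matrix.mulVec (E.T.map (p.value 0)) p.w) := by
    rw [← extSoul_sandwich p.z_mem (h.transgression_mem hε), ← transgression_shift h]
    have hz : Matrix.vecMul p.z (signMat _ E.lev * E.T.map (p.value 1)) = fun α =>
        ∑ β, (-1 : ℝ) ^ E.lev β • (p.z β * p.value 1 (E.T β α)) := by
      ext α
      simp only [Matrix.vecMul, dotProduct, signMat_mul_apply, mul_smul_comm, Matrix.map_apply]
    rw [hz]
    rfl
  rw [h2]
  rw [zero_smul, add_zero, wilsonVariation] at h1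
  convert! h1 using 1
  simp only [sandwich_vecMul, sandwich_mulVec, sandwich_add, sandwich_neg, mul_assoc]
  abel

theorem wilsonLoop_variation (hε : ∀ α β, ε α β ∈ M.gr (E.lev β - E.lev α)) {φ : SuperCurve M Λ}
    (hφ : φ.OnShell) (hl : φ.IsLoop) :
    ∑ α, (-1 : ℝ) ^ E.lev α • wilsonVariation E ε φ α α = 0 := by
  obtain ⟨U, W, h⟩ := exists_fundamental_dtheta φ E.T_mem
  have hU : ∀ α β, wilson E.T φ 1 0 α β ∈ Λ.gr (E.lev β - E.lev α + 0) := fun α β => by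
    rw [wilson_eq φ E.T_mem h, h.eval_right, mul_one, add_zero]
    exact evalAt_mem ((h.mem Λ.finite (fun α β => φ.dtheta_mem (E.T_mem α β))).1 α β) 1
  have hv : ∀ A : Matrix ι ι M.carrier, A.map (φ.value 1) = A.map (φ.value 0) := fun A => by
    ext α β
    exact hl _
  -- Degree 0: since ε(1) = ε(0) on a closed curve, the two ε terms cancel in the supertrace.
  have h1 := supertrace_comm (lev := E.lev) hU (B := ε.map (φ.value 0)) fun α β => by
    rw [sub_zero]
    exact φ.value_mem 0 (hε α β)
  -- V has degree -1 and T degree 1 relative to the levels, so cyclicity costs a sign and the two T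
  -- terms cancel.
  have h2 := supertrace_comm (lev := E.lev) (k := -1)
    (A := transgression E ε φ * signMat _ E.lev) (B := E.T.map (φ.value 0))
    (fun α β => by
      rw [mul_signMat_apply]
      exact Submodule.smul_mem _ _ (h.transgression_mem hε α β)) fun α β => by
    rw [sub_neg_eq_add]
    exact φ.value_mem 0 (E.T_mem α β)
  -- The diagonal of δ_B V is the τ-coefficient of the diagonal of V on the shifted curve, which
  -- already vanishes there.
  have h3 : ∀ α, transgression E ε φ.shift α α = 0 := transgression_diag_eq_zero E hε
    fun i hi f hf => hφ.dtheta_shift_eq_zero hi hf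
  have h4 : ∀ α, (E.T.map (φ.value 0) * (transgression E ε φ * signMat Λ.carrier E.lev)) α α =
      (signMat Λ.carrier E.lev * (E.T.map (φ.value 0) * transgression E ε φ)) α α := fun α => by
    rw [← mul_assoc, mul_signMat_apply, signMat_mul_apply]
  have h5 : ∀ α, (signMat Λ.carrier E.lev * (transgression E ε φ.shift).map Λ.extSoul) α α = 0 :=
    fun α => by rw [signMat_mul_apply, Matrix.map_apply, h3, map_zero, smul_zero]
  simp only [wilsonVariation, hv, Matrix.add_apply, Matrix.neg_apply, h5, add_zero, smul_add,
    smul_neg, Finset.sum_add_distrib, Finset.sum_neg_distrib, h1, h2, h4]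
  norm_num

end main

end WilsonLine

end

open WilsonLine
theorem mainTheorem2 (M : NQAlg.{u}) {ι : Type} [Fintype ι] [DecidableEq ι]
    (E : QRep M ι) (ε : Matrix ι ι M.carrier)
    (hε : ∀ α β, ε α β ∈ M.gr (E.lev β - E.lev α)) :
    -- the path-ordered exponentials converge and the integral defining `V` exists
    (∀ (Λ : TestAlg.{v}) (φ : SuperCurve M Λ),
      (∀ (s : ℝ) (t t' : unitInterval) (α β : ι),
        HasSeriesSum (fun q => wilsonTerm (E.T + s • E.deltaT ε) φ t t' q α β)
          (wilson (E.T + s • E.deltaT ε) φ t t' α β)) ∧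
      ∀ α β, HasIntegral01 (fun t => transgressionIntegrand E ε φ t α β)
        (transgression E ε φ α β)) ∧
    -- the variation of the Wilson line
    (∀ (Λ : TestAlg.{v}) (φ : SuperCurve M Λ) (α β : ι),
      HasDerivative (fun s : ℝ => wilson (E.T + s • E.deltaT ε) φ 1 0 α β)
        (-(∑ δ, φ.value 1 (ε α δ) * wilson E.T φ 1 0 δ β) +
          ∑ δ, wilson E.T φ 1 0 α δ * φ.value 0 (ε δ β) +
          (-1 : ℝ) ^ E.lev α •
            deltaB (fun (Λ' : TestAlg.{v}) φ' => (transgression E ε φ' α β : Λ'.carrier)) Λ φ +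
          ∑ δ, (-1 : ℝ) ^ E.lev α • (φ.value 1 (E.T α δ) * transgression E ε φ δ β) +
          ∑ δ, (-1 : ℝ) ^ E.lev δ • (transgression E ε φ α δ * φ.value 0 (E.T δ β))) 0) ∧
    -- the compact form `δ_ε U_C = δ_B (ζ V ζ)`
    (∀ (Λ : TestAlg.{v}) (p : FramedCurve M E Λ),
      HasDerivative (changedSection E ε p)
        (deltaBHat (fun (Λ' : TestAlg.{v}) (p' : FramedCurve M E Λ') =>
          sandwich p'.z (transgression E ε p'.toSuperCurve) p'.w) Λ p) 0) ∧
    -- covariance of the Wilson line for `ε` of degree zero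
    ((∀ α β, ε α β ∈ M.gr 0) → ∀ (Λ : TestAlg.{v}) (φ : SuperCurve M Λ), φ.OnShell →
      ∀ α β, HasDerivative (fun s : ℝ => wilson (E.T + s • E.deltaT ε) φ 1 0 α β)
        (-(∑ δ, φ.value 1 (ε α δ) * wilson E.T φ 1 0 δ β) +
          ∑ δ, wilson E.T φ 1 0 α δ * φ.value 0 (ε δ β)) 0) ∧
    -- Wilson loops do not depend on the trivialization
    (∀ (Λ : TestAlg.{v}) (φ : SuperCurve M Λ), φ.OnShell → φ.IsLoop →
      HasDerivative (fun s : ℝ => wilsonLoop E.lev (E.T + s • E.deltaT ε) φ) 0 0) := by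
  have hS : ∀ (Λ : TestAlg.{v}) (φ : SuperCurve M Λ) (α β : ι), wilsonVariation E ε φ α β =
      -(∑ δ, φ.value 1 (ε α δ) * wilson E.T φ 1 0 δ β) +
      ∑ δ, wilson E.T φ 1 0 α δ * φ.value 0 (ε δ β) +
      (-1 : ℝ) ^ E.lev α •
        deltaB (fun (Λ' : TestAlg.{v}) φ' => (transgression E ε φ' α β : Λ'.carrier)) Λ φ +
      ∑ δ, (-1 : ℝ) ^ E.lev α • (φ.value 1 (E.T α δ) * transgression E ε φ δ β) +
      ∑ δ, (-1 : ℝ) ^ E.lev δ • (transgression E ε φ α δ * φ.value 0 (E.T δ β)) := by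
    intro Λ φ α β
    simp only [wilsonVariation, Matrix.add_apply, Matrix.neg_apply, signMat_mul_apply,
      Matrix.mul_apply (M := transgression E ε φ * _), mul_signMat_apply, smul_mul_assoc]
    rw [← Finset.smul_sum]
    rfl
  refine ⟨fun Λ φ => ⟨fun s t t' α β => ?_, fun α β => ?_⟩, fun Λ φ α β => ?_,
    fun Λ p => hasDerivative_changedSection hε p, fun hε0 Λ φ hφ α β => ?_, fun Λ φ hφ hl => ?_⟩
  · exact hasSeriesSum_wilson (lev := E.lev) φ (fun α β => Submodule.add_mem _ (E.T_mem α β)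
      (Submodule.smul_mem _ s (E.deltaT_mem hε α β))) t t' α β
  · obtain ⟨U, W, h⟩ := exists_fundamental_dtheta φ E.T_mem
    rw [transgression_eq φ E ε h]
    exact hasIntegral01_transgression φ E ε h α β
  · rw [← hS]
    exact hasDerivative_wilsonVariation hε φ α β
  · have h1 := hasDerivative_wilsonVariation hε φ α β
    have h2 : transgression E ε φ = 0 :=
      transgression_eq_zero E fun α β => hφ.dtheta_eq_zero le_rfl (hε0 α β)
    -- Vanishing of V on φ alone would not control δ_B V, which is read off from the shifted curve.
    have h3 : transgression E ε φ.shift = 0 :=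
      transgression_eq_zero E fun α β => hφ.dtheta_shift_eq_zero le_rfl (hε0 α β)
    rw [hS] at h1
    simpa only [deltaB, h2, h3, Matrix.zero_apply, map_zero, smul_zero, mul_zero, zero_mul,
      Finset.sum_const_zero, add_zero] using h1
  · rw [← wilsonLoop_variation hε hφ hl]
    refine HasDerivative.sum fun α _ => ?_
    exact (hasDerivative_wilsonVariation hε φ α α).map (((-1 : ℝ) ^ E.lev α) • LinearMap.id)
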